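/- Let $\mathbf k=\mathbb R$ or $\mathbb C$. Manifolds are finite dimensional and smooth (if $\mathbf k=\mathbb R$) or complex (if $\mathbf k=\mathbb C$), without boundary; vector fields and bivector fields are smooth, respectively holomorphic, and $u\wedge v=u\otimes v-v\otimes u$. A Poisson manifold is a manifold $Y$ with a bivector field $\pi_Y$ such that $[\pi_Y,\pi_Y]=0$ for the Schouten bracket. A Lie bialgebra $(\mathfrak g,\delta_{\mathfrak g})$ is a finite dimensional Lie algebra $\mathfrak g$ over $\mathbf k$ with a linear map $\delta_{\mathfrak g}:\mathfrak g\to\wedge^2\mathfrak g$ whose dual map is a Lie bracket on $\mathfrak g^*$ and which satisfies $\delta_{\mathfrak g}[x,y]=[x,\delta_{\mathfrak g}(y)]-[y,\delta_{\mathfrak g}(x)]$. Its dual Lie bialgebra $(\mathfrak g^*,\delta_{\mathfrak g^*})$ has as bracket the dual map of $\delta_{\mathfrak g}$ and as cobracket the dual map of the bracket of $\mathfrak g$. The double Lie algebra is $\mathfrak d=\mathfrak g\oplus\mathfrak g^*$ with the unique Lie bracket that extends those of $\mathfrak g$ and $\mathfrak g^*$ and leaves $\langle x+\xi,y+\eta\rangle_{\mathfrak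 d}=\langle x,\eta\rangle+\langle\xi,y\rangle$ invariant. The double Lie bialgebra $(\mathfrak d,\delta_{\mathfrak d})$ has $\delta_{\mathfrak d}|_{\mathfrak g}=\delta_{\mathfrak g}$ and $\delta_{\mathfrak d}|_{\mathfrak g^*}=-\delta_{\mathfrak g^*}$. Let $(\mathfrak d',\delta_{\mathfrak d'})$ be the dual Lie bialgebra of $(\mathfrak d,\delta_{\mathfrak d})$, where $\mathfrak d'=\mathfrak g^*\oplus\mathfrak g$ is identified with the dual space of $\mathfrak d$ by $\langle a,(\xi,x)\rangle=\langle \xi-x,a\rangle_{\mathfrak d}$; as a Lie algebra $\mathfrak d'$ is the direct product of $\mathfrak g^*$ and $\mathfrak g$. A left (respectively right) Poisson action of $(\mathfrak g,\delta_{\mathfrak g})$ on a Poisson manifold $(Y,\pi_Y)$ is a Lie algebra anti-homomorphism (respectively homomorphism) $\sigma$ from $\mathfrak g$ to the vector fields on $Y$ such that $[\sigma(x),\pi_Y]=\sigma(\delta_{\mathfrak g}(x))$ for all $x\in\mathfrak g$, where $\sigma(x\wedge y)=\sigma(x)\wedge\sigma(y)$. Let $(X,\pi_X)$ and $(Y,\pi_Y)$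 be Poisson manifolds, let $\rho$ be a right Poisson action of $(\mathfrak g^*,\delta_{\mathfrak g^*})$ on $(X,\pi_X)$ and let $\lambda$ be a left Poisson action of $(\mathfrak g,\delta_{\mathfrak g})$ on $(Y,\pi_Y)$. Let $\{x_i\}_{i=1}^m$ be any basis of $\mathfrak g$ and $\{\xi_i\}_{i=1}^m$ the dual basis of $\mathfrak g^*$. Then the bivector field $$\pi_X\times_{(\rho,\lambda)}\pi_Y=(\pi_X,\pi_Y)-\sum_{i=1}^m(\rho(\xi_i),0)\wedge(0,\lambda(x_i))$$ on $X\times Y$ is Poisson, and the map $$\rho_0(\xi,x)=(\rho(\xi),0)+(0,-\lambda(x)),\qquad \xi\in\mathfrak g^*,\ x\in\mathfrak g,$$ from $\mathfrak d'$ to the vector fields on $X\times Y$ is a right Poisson action of the Lie bialgebra $(\mathfrak d',\delta_{\mathfrak d'})$ on $(X\times Y,\ \pi_X\times_{(\rho,\lambda)}\pi_Y)$. -/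

import Mathlib

open scoped TensorProduct Manifold ContDiff
open Module

set_option linter.unusedSectionVars false

noncomputable section

section TensorConventions

variable {𝕜 : Type*} [Field 𝕜] {V : Type*} [AddCommGroup V] [Module 𝕜 V]

/-- `wedge u v = u ⊗ v - v ⊗ u`. -/
def wedge (u v : V) : V ⊗[𝕜] V := u ⊗ₜ[𝕜] v - v ⊗ₜ[𝕜] u

/-- Contraction of the first tensor factor: `sharp ξ (∑ uᵢ ⊗ vᵢ) = ∑ ⟨ξ, uᵢ⟩ vᵢ`. -/
def sharp (ξ : Dual 𝕜 V) : V ⊗[𝕜] V →ₗ[𝕜] V :=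
  (TensorProduct.lid 𝕜 V).toLinearMap ∘ₗ LinearMap.rTensor V ξ

/-- Evaluation of a 2-tensor on two covectors:
`tensorEval ξ η (∑ uᵢ ⊗ vᵢ) = ∑ ⟨ξ, uᵢ⟩ ⟨η, vᵢ⟩`. -/
def tensorEval (ξ η : Dual 𝕜 V) : V ⊗[𝕜] V →ₗ[𝕜] 𝕜 := η ∘ₗ sharp ξ

/-- `IsSkew t` says that the 2-tensor `t` lies in `∧² V ⊆ V ⊗ V`. -/
def IsSkew (t : V ⊗[𝕜] V) : Prop := TensorProduct.comm 𝕜 V V t = -t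

@[simp] theorem sharp_tmul (ξ : Dual 𝕜 V) (u v : V) : sharp ξ (u ⊗ₜ[𝕜] v) = ξ u • v := by
  simp [sharp]

@[simp] theorem tensorEval_tmul (ξ η : Dual 𝕜 V) (u v : V) :
    tensorEval ξ η (u ⊗ₜ[𝕜] v) = ξ u * η v := by
  simp [tensorEval]

theorem apply_sharp (ξ η : Dual 𝕜 V) (t : V ⊗[𝕜] V) : η (sharp ξ t) = tensorEval ξ η t := rfl

theorem sharp_add (ξ η : Dual 𝕜 V) (t : V ⊗[𝕜] V) : sharp (ξ + η) t = sharp ξ t + sharp η t := by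
  simp [sharp, LinearMap.rTensor_add]

theorem sharp_smul (c : 𝕜) (ξ : Dual 𝕜 V) (t : V ⊗[𝕜] V) : sharp (c • ξ) t = c • sharp ξ t := by
  simp [sharp, LinearMap.rTensor_smul]

theorem tensorEval_comm (ξ η : Dual 𝕜 V) (t : V ⊗[𝕜] V) :
    tensorEval ξ η (TensorProduct.comm 𝕜 V V t) = tensorEval η ξ t := by
  induction t with
  | zero => simp
  | tmul u v => simp [mul_comm]
  | add s t hs ht => simp [hs, ht]

theorem tensor_ext {t s : V ⊗[𝕜] V} (h : ∀ ξ η : Dual 𝕜 V, tensorEval ξ η t = tensorEval ξ η s) :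
    t = s := by
  have hs : ∀ ξ, sharp ξ t = sharp ξ s := fun ξ => by
    rw [← sub_eq_zero, ← Module.forall_dual_apply_eq_zero_iff 𝕜]
    intro η
    rw [map_sub, apply_sharp, apply_sharp, h, sub_self]
  classical
  let b := Basis.ofVectorSpace 𝕜 V
  have key : ∀ t : V ⊗[𝕜] V, ∀ i, (TensorProduct.equivFinsuppOfBasisLeft b t) i
      = sharp (b.coord i) t := by
    intro t i
    induction t with
    | zero => simp
    | tmul u v => simp [Basis.coord]
    | add s t hs ht => simp [hs, ht]
  apply (TensorProduct.equivFinsuppOfBasisLeft b).injective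
  ext i
  rw [key, key, hs]

theorem isSkew_iff {t : V ⊗[𝕜] V} :
    IsSkew t ↔ ∀ ξ η : Dual 𝕜 V, tensorEval ξ η t = -tensorEval η ξ t := by
  constructor
  · intro h ξ η
    rw [← tensorEval_comm, h, map_neg]
  · intro h
    apply tensor_ext
    intro ξ η
    rw [tensorEval_comm, map_neg, h]

theorem tensorEval_map {W : Type*} [AddCommGroup W] [Module 𝕜 W] (f : V →ₗ[𝕜] W)
    (ξ η : Dual 𝕜 W) (t : V ⊗[𝕜] V) :
    tensorEval ξ η (TensorProduct.map f f t) = tensorEval (ξ ∘ₗ f) (η ∘ₗ f) t := by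
  induction t with
  | zero => simp
  | tmul u v => simp
  | add s t hs ht => simp [hs, ht]

end TensorConventions

/-! ### Lie bialgebras -/

/-- The bracket on the dual space `g*` which is dual to `δ : g → ∧² g`:
`⟨[ξ, η], x⟩ = δ(x)(ξ, η)`. -/
def dualBracket {𝕜 g : Type*} [Field 𝕜] [AddCommGroup g] [Module 𝕜 g]
    (δ : g →ₗ[𝕜] g ⊗[𝕜] g) (ξ η : Dual 𝕜 g) : Dual 𝕜 g :=
  tensorEval ξ η ∘ₗ δ

/-- A Lie bialgebra structure on the Lie algebra `g`. -/
structure LieBialgebra (𝕜 g : Type*) [Field 𝕜] [LieRing g] [LieAlgebra 𝕜 g] where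
  cobracket : g →ₗ[𝕜] g ⊗[𝕜] g
  skew : ∀ x, IsSkew (cobracket x)
  coJacobi : ∀ ξ η ζ : Dual 𝕜 g,
    dualBracket cobracket ξ (dualBracket cobracket η ζ)
      + dualBracket cobracket η (dualBracket cobracket ζ ξ)
      + dualBracket cobracket ζ (dualBracket cobracket ξ η) = 0
  cocycle : ∀ x y : g, cobracket ⁅x, y⁆ = ⁅x, cobracket y⁆ - ⁅y, cobracket x⁆

namespace LieBialgebra

section DualLieAlgebra

variable {𝕜 g : Type*} [Field 𝕜] [LieRing g] [LieAlgebra 𝕜 g]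

/-- The dual space `g*` of a Lie bialgebra `g`, with the Lie bracket dual to the cobracket. -/
def Dual (_B : LieBialgebra 𝕜 g) : Type _ := Module.Dual 𝕜 g

variable (B : LieBialgebra 𝕜 g)

instance : AddCommGroup B.Dual := inferInstanceAs (AddCommGroup (Module.Dual 𝕜 g))
instance : Module 𝕜 B.Dual := inferInstanceAs (Module 𝕜 (Module.Dual 𝕜 g))
instance [FiniteDimensional 𝕜 g] : FiniteDimensional 𝕜 B.Dual :=
  inferInstanceAs (FiniteDimensional 𝕜 (Module.Dual 𝕜 g))

/-- As a vector space, `B.Dual` is the dual of `g`. -/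
def ofDual : B.Dual ≃ₗ[𝕜] Module.Dual 𝕜 g := LinearEquiv.refl 𝕜 (Module.Dual 𝕜 g)

/-- The element of `B.Dual` given by a linear functional on `g`. -/
def toDual : Module.Dual 𝕜 g ≃ₗ[𝕜] B.Dual := B.ofDual.symm

@[simp] theorem ofDual_toDual (ξ : Module.Dual 𝕜 g) : B.ofDual (B.toDual ξ) = ξ := rfl

@[simp] theorem toDual_ofDual (ξ : B.Dual) : B.toDual (B.ofDual ξ) = ξ := rfl

variable {B} in
theorem dual_ext {ξ η : B.Dual} (h : ∀ x, B.ofDual ξ x = B.ofDual η x) : ξ = η :=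
  B.ofDual.injective (LinearMap.ext h)

/-- The coadjoint action of `g` on `g*`: `⟨ad*_x ξ, y⟩ = ⟨ξ, [y, x]⟩`. -/
def coadL (x : g) (ξ : B.Dual) : B.Dual :=
  B.toDual (-(B.ofDual ξ ∘ₗ LieAlgebra.ad 𝕜 g x))

/-- The coadjoint action of `g*` on `g`: `⟨ad*_ξ x, η⟩ = ⟨x, [η, ξ]⟩`. -/
def coadR (ξ : B.Dual) (x : g) : g := -sharp (B.ofDual ξ) (B.cobracket x)

instance : Bracket B.Dual B.Dual :=
  ⟨fun ξ η => B.toDual (dualBracket B.cobracket (B.ofDual ξ) (B.ofDual η))⟩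

theorem lie_apply (ξ η : B.Dual) (x : g) :
    B.ofDual ⁅ξ, η⁆ x = tensorEval (B.ofDual ξ) (B.ofDual η) (B.cobracket x) := rfl

theorem lie_skew_dual (ξ η : B.Dual) : ⁅ξ, η⁆ = -⁅η, ξ⁆ :=
  dual_ext fun x => by
    rw [map_neg, LinearMap.neg_apply, lie_apply, lie_apply]
    exact isSkew_iff.1 (B.skew x) _ _

theorem coadL_apply (x y : g) (ξ : B.Dual) : B.ofDual (B.coadL x ξ) y = B.ofDual ξ ⁅y, x⁆ := by
  rw [coadL, ofDual_toDual, LinearMap.neg_apply, LinearMap.comp_apply, LieAlgebra.ad_apply,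
    ← map_neg, lie_skew]

theorem apply_coadR (ξ η : B.Dual) (x : g) :
    B.ofDual η (B.coadR ξ x) = B.ofDual ⁅η, ξ⁆ x := by
  rw [lie_skew_dual, map_neg, LinearMap.neg_apply, lie_apply, coadR, map_neg, apply_sharp]

variable [CharZero 𝕜]

instance : LieRing B.Dual where
  add_lie ξ η ζ := dual_ext fun x => by
    simp only [lie_apply, map_add, LinearMap.add_apply, tensorEval, LinearMap.comp_apply, sharp_add]
  lie_add ξ η ζ := dual_ext fun x => by
    simp only [lie_apply, map_add, LinearMap.add_apply, tensorEval, LinearMap.comp_apply]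
  lie_self ξ := by
    have h : (2 : 𝕜) • ⁅ξ, ξ⁆ = 0 := by
      rw [two_smul]
      exact eq_neg_iff_add_eq_zero.1 (B.lie_skew_dual ξ ξ)
    exact (smul_eq_zero.1 h).resolve_left two_ne_zero
  leibniz_lie ξ η ζ := by
    have h : ⁅ξ, ⁅η, ζ⁆⁆ + ⁅η, ⁅ζ, ξ⁆⁆ + ⁅ζ, ⁅ξ, η⁆⁆ = 0 := B.coJacobi ξ η ζ
    have hn : ⁅η, ⁅ζ, ξ⁆⁆ = -⁅η, ⁅ξ, ζ⁆⁆ := dual_ext fun x => by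
      rw [B.lie_skew_dual ζ ξ]
      simp only [lie_apply, map_neg, LinearMap.neg_apply, tensorEval, LinearMap.comp_apply]
    rw [B.lie_skew_dual ζ ⁅ξ, η⁆, hn] at h
    rw [← sub_eq_zero, ← h]
    abel

instance : LieAlgebra 𝕜 B.Dual where
  lie_smul c ξ η := dual_ext fun x => by
    simp only [lie_apply, map_smul, LinearMap.smul_apply, tensorEval, LinearMap.comp_apply]

end DualLieAlgebra

section DualBialgebra

variable {𝕜 g : Type*} [Field 𝕜] [CharZero 𝕜] [LieRing g] [LieAlgebra 𝕜 g]
  (B : LieBialgebra 𝕜 g)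

theorem apply_inj {x y : g} (h : ∀ ξ : B.Dual, B.ofDual ξ x = B.ofDual ξ y) : x = y := by
  rw [← sub_eq_zero, ← Module.forall_dual_apply_eq_zero_iff 𝕜]
  intro η
  have := h (B.toDual η)
  rw [ofDual_toDual] at this
  rw [map_sub, this, sub_self]

theorem tensorEval_lie (x : g) (ξ η : B.Dual) (t : g ⊗[𝕜] g) :
    tensorEval (B.ofDual ξ) (B.ofDual η) ⁅x, t⁆
      = -tensorEval (B.ofDual (B.coadL x ξ)) (B.ofDual η) t
        - tensorEval (B.ofDual ξ) (B.ofDual (B.coadL x η)) t := by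
  induction t with
  | zero => simp
  | tmul u v =>
    simp only [TensorProduct.LieModule.lie_tmul_right, map_add, tensorEval_tmul, coadL_apply]
    rw [← lie_skew x u, ← lie_skew x v, map_neg, map_neg]
    ring
  | add s t hs ht => rw [lie_add]; simp only [map_add, hs, ht]; ring

theorem lie_apply_lie (ξ η : B.Dual) (x y : g) :
    B.ofDual ⁅ξ, η⁆ ⁅x, y⁆ = B.ofDual ⁅B.coadL y ξ, η⁆ x + B.ofDual ⁅ξ, B.coadL y η⁆ x
      - B.ofDual ⁅B.coadL x ξ, η⁆ y - B.ofDual ⁅ξ, B.coadL x η⁆ y := by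
  simp only [lie_apply, B.cocycle, map_sub, tensorEval_lie]
  ring

variable [FiniteDimensional 𝕜 g]

/-- The cobracket on `g*` dual to the bracket of `g`. -/
def dualCobracket : B.Dual →ₗ[𝕜] B.Dual ⊗[𝕜] B.Dual :=
  (TensorProduct.congr B.toDual B.toDual).toLinearMap ∘ₗ
    (TensorProduct.dualDistribEquiv 𝕜 g g).symm.toLinearMap ∘ₗ
    LinearMap.lcomp 𝕜 𝕜 (LieModule.toModuleHom 𝕜 g g : g ⊗[𝕜] g →ₗ[𝕜] g) ∘ₗ
    B.ofDual.toLinearMap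

/-- Evaluation at `x`, as a functional on `g*`. -/
def evalAt (x : g) : Module.Dual 𝕜 B.Dual := Module.Dual.eval 𝕜 g x ∘ₗ B.ofDual.toLinearMap

@[simp] theorem evalAt_apply (x : g) (ξ : B.Dual) : B.evalAt x ξ = B.ofDual ξ x := rfl

theorem exists_evalAt (f : Module.Dual 𝕜 B.Dual) : ∃ x, B.evalAt x = f := by
  obtain ⟨x, hx⟩ := (Module.evalEquiv 𝕜 g).surjective (f ∘ₗ B.toDual.toLinearMap)
  exact ⟨x, LinearMap.ext fun ξ => LinearMap.congr_fun hx (B.ofDual ξ)⟩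

theorem tensorEval_dualCobracket (x y : g) (ξ : B.Dual) :
    tensorEval (B.evalAt x) (B.evalAt y) (B.dualCobracket ξ) = B.ofDual ξ ⁅x, y⁆ := by
  have key : ∀ t : Module.Dual 𝕜 g ⊗[𝕜] Module.Dual 𝕜 g,
      tensorEval (B.evalAt x) (B.evalAt y) (TensorProduct.congr B.toDual B.toDual t)
        = TensorProduct.dualDistrib 𝕜 g g t (x ⊗ₜ y) := by
    intro t
    induction t with
    | zero => simp
    | tmul u v => simp
    | add s t hs ht => simp [hs, ht]
  have h2 : ∀ φ : Module.Dual 𝕜 (g ⊗[𝕜] g),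
      TensorProduct.dualDistrib 𝕜 g g ((TensorProduct.dualDistribEquiv 𝕜 g g).symm φ) = φ :=
    fun φ => (TensorProduct.dualDistribEquiv 𝕜 g g).apply_symm_apply φ
  simp only [dualCobracket, LinearMap.comp_apply, LinearEquiv.coe_coe, key, h2]
  simp

/-- The Lie bialgebra `g*` dual to the Lie bialgebra `g`. -/
def dual : LieBialgebra 𝕜 B.Dual where
  cobracket := B.dualCobracket
  skew ξ := isSkew_iff.2 fun f h => by
    obtain ⟨x, rfl⟩ := B.exists_evalAt f
    obtain ⟨y, rfl⟩ := B.exists_evalAt h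
    rw [tensorEval_dualCobracket, tensorEval_dualCobracket, ← map_neg, lie_skew]
  coJacobi f h k := by
    obtain ⟨x, rfl⟩ := B.exists_evalAt f
    obtain ⟨y, rfl⟩ := B.exists_evalAt h
    obtain ⟨z, rfl⟩ := B.exists_evalAt k
    have hb : ∀ x y, dualBracket B.dualCobracket (B.evalAt x) (B.evalAt y) = B.evalAt ⁅x, y⁆ :=
      fun x y => LinearMap.ext fun ξ => B.tensorEval_dualCobracket x y ξ
    rw [hb, hb, hb, hb, hb, hb]
    ext ξ
    simp only [LinearMap.add_apply, evalAt_apply, ← map_add, lie_jacobi, map_zero,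
      LinearMap.zero_apply]
  cocycle ξ η := tensor_ext fun f h => by
    obtain ⟨x, rfl⟩ := B.exists_evalAt f
    obtain ⟨y, rfl⟩ := B.exists_evalAt h
    have key : ∀ (ξ : B.Dual) (t : B.Dual ⊗[𝕜] B.Dual),
        tensorEval (B.evalAt x) (B.evalAt y) ⁅ξ, t⁆
          = -tensorEval (B.evalAt (B.coadR ξ x)) (B.evalAt y) t
            - tensorEval (B.evalAt x) (B.evalAt (B.coadR ξ y)) t := by
      intro ξ t
      induction t with
      | zero => simp
      | tmul u v =>
        simp only [TensorProduct.LieModule.lie_tmul_right, map_add, tensorEval_tmul, evalAt_apply,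
          apply_coadR]
        rw [← lie_skew ξ u, ← lie_skew ξ v, map_neg, map_neg, LinearMap.neg_apply,
          LinearMap.neg_apply]
        ring
      | add s t hs ht => rw [lie_add]; simp only [map_add, hs, ht]; ring
    have hl : ∀ (ξ η : B.Dual) (x y : g), B.ofDual η ⁅B.coadR ξ x, y⁆
        = B.ofDual ⁅B.coadL y η, ξ⁆ x := by
      intro ξ η x y
      rw [← apply_coadR, coadL_apply]
    have hr : ∀ (ξ η : B.Dual) (x y : g), B.ofDual η ⁅x, B.coadR ξ y⁆
        = -B.ofDual ⁅B.coadL x η, ξ⁆ y := by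
      intro ξ η x y
      rw [← apply_coadR, coadL_apply, ← map_neg, lie_skew]
    rw [map_sub, key, key]
    simp only [tensorEval_dualCobracket, lie_apply_lie, hl, hr]
    rw [← lie_skew (B.coadL y η) ξ, ← lie_skew (B.coadL x η) ξ]
    simp only [map_neg, LinearMap.neg_apply]
    ring

end DualBialgebra

section Double

variable {𝕜 g : Type*} [Field 𝕜] [CharZero 𝕜] [LieRing g] [LieAlgebra 𝕜 g]

/-- The double `d = g ⊕ g*` of a Lie bialgebra, with elements `x + ξ` written `(x, ξ)`. -/
def Double (B : LieBialgebra 𝕜 g) : Type _ := g × B.Dual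

variable (B : LieBialgebra 𝕜 g)

instance : AddCommGroup B.Double := inferInstanceAs (AddCommGroup (g × B.Dual))
instance : Module 𝕜 B.Double := inferInstanceAs (Module 𝕜 (g × B.Dual))
instance [FiniteDimensional 𝕜 g] : FiniteDimensional 𝕜 B.Double :=
  inferInstanceAs (FiniteDimensional 𝕜 (g × B.Dual))

/-- The inclusion `g → d`. -/
def inl : g →ₗ[𝕜] B.Double := LinearMap.inl 𝕜 g B.Dual

/-- The inclusion `g* → d`. -/
def inr : B.Dual →ₗ[𝕜] B.Double := LinearMap.inr 𝕜 g B.Dual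

/-- The bracket `[x + ξ, y + η] = [x, y] + ad*_ξ y - ad*_η x + [ξ, η] + ad*_x η - ad*_y ξ`. -/
instance : Bracket B.Double B.Double :=
  ⟨fun a b => (⁅a.1, b.1⁆ + B.coadR a.2 b.1 - B.coadR b.2 a.1,
    ⁅a.2, b.2⁆ + B.coadL a.1 b.2 - B.coadL b.1 a.2)⟩

variable {B} in
theorem Double.ext {a b : B.Double} (h₁ : a.1 = b.1) (h₂ : a.2 = b.2) : a = b := Prod.ext h₁ h₂

theorem double_lie_fst (a b : B.Double) :
    ⁅a, b⁆.1 = ⁅a.1, b.1⁆ + B.coadR a.2 b.1 - B.coadR b.2 a.1 := rfl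

theorem double_lie_snd (a b : B.Double) :
    ⁅a, b⁆.2 = ⁅a.2, b.2⁆ + B.coadL a.1 b.2 - B.coadL b.1 a.2 := rfl

theorem double_add_fst (a b : B.Double) : (a + b).1 = a.1 + b.1 := rfl
theorem double_add_snd (a b : B.Double) : (a + b).2 = a.2 + b.2 := rfl
theorem double_smul_fst (c : 𝕜) (a : B.Double) : (c • a).1 = c • a.1 := rfl
theorem double_smul_snd (c : 𝕜) (a : B.Double) : (c • a).2 = c • a.2 := rfl

theorem coadR_add (ξ : B.Dual) (x y : g) : B.coadR ξ (x + y) = B.coadR ξ x + B.coadR ξ y := by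
  simp [coadR, add_comm]
theorem coadR_sub (ξ : B.Dual) (x y : g) : B.coadR ξ (x - y) = B.coadR ξ x - B.coadR ξ y := by
  simp [coadR, sub_eq_add_neg, add_comm]
theorem coadR_smul (c : 𝕜) (ξ : B.Dual) (x : g) : B.coadR ξ (c • x) = c • B.coadR ξ x := by
  simp [coadR]
theorem coadL_add (x : g) (ξ η : B.Dual) : B.coadL x (ξ + η) = B.coadL x ξ + B.coadL x η :=
  dual_ext fun y => by simp only [coadL_apply, map_add, LinearMap.add_apply]
theorem coadL_sub (x : g) (ξ η : B.Dual) : B.coadL x (ξ - η) = B.coadL x ξ - B.coadL x η :=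
  dual_ext fun y => by simp only [coadL_apply, map_sub, LinearMap.sub_apply]
theorem coadL_smul (c : 𝕜) (x : g) (ξ : B.Dual) : B.coadL x (c • ξ) = c • B.coadL x ξ :=
  dual_ext fun y => by simp only [coadL_apply, map_smul, LinearMap.smul_apply]
theorem add_coadR (ξ η : B.Dual) (x : g) : B.coadR (ξ + η) x = B.coadR ξ x + B.coadR η x := by
  simp [coadR, sharp_add, add_comm]
theorem smul_coadR (c : 𝕜) (ξ : B.Dual) (x : g) : B.coadR (c • ξ) x = c • B.coadR ξ x := by
  simp [coadR, sharp_smul]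
theorem add_coadL (x y : g) (ξ : B.Dual) : B.coadL (x + y) ξ = B.coadL x ξ + B.coadL y ξ :=
  dual_ext fun z => by simp only [coadL_apply, map_add, LinearMap.add_apply, lie_add]
theorem smul_coadL (c : 𝕜) (x : g) (ξ : B.Dual) : B.coadL (c • x) ξ = c • B.coadL x ξ :=
  dual_ext fun z => by simp only [coadL_apply, map_smul, LinearMap.smul_apply, lie_smul]

/-- The invariant form `⟨x + ξ, y + η⟩ = ⟨x, η⟩ + ⟨ξ, y⟩` on the double. -/
def doubleForm (a b : B.Double) : 𝕜 := B.ofDual b.2 a.1 + B.ofDual a.2 b.1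

theorem doubleForm_comm (a b : B.Double) : B.doubleForm a b = B.doubleForm b a := add_comm _ _

theorem lie_apply_skew (ξ η : B.Dual) (x : g) : B.ofDual ⁅ξ, η⁆ x = -B.ofDual ⁅η, ξ⁆ x := by
  rw [lie_skew_dual, map_neg, LinearMap.neg_apply]

theorem apply_lie_skew (ξ : B.Dual) (x y : g) : B.ofDual ξ ⁅x, y⁆ = -B.ofDual ξ ⁅y, x⁆ := by
  rw [← map_neg, lie_skew]

theorem doubleForm_invariant (a b c : B.Double) :
    B.doubleForm ⁅a, b⁆ c = B.doubleForm a ⁅b, c⁆ := by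
  simp only [doubleForm, double_lie_fst, double_lie_snd, map_add, map_sub, LinearMap.add_apply,
    LinearMap.sub_apply, apply_coadR, coadL_apply]
  linear_combination B.lie_apply_skew c.2 a.2 b.1 - B.apply_lie_skew a.2 c.1 b.1
    + B.apply_lie_skew b.2 a.1 c.1 - B.lie_apply_skew b.2 c.2 a.1

instance : LieRing B.Double where
  add_lie a b c := Double.ext
    (by simp only [double_lie_fst, double_add_fst, double_add_snd, add_lie, coadR_add, add_coadR]
        abel)
    (by simp only [double_lie_snd, double_add_fst, double_add_snd, add_lie, coadL_add, add_coadL]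
        abel)
  lie_add a b c := Double.ext
    (by simp only [double_lie_fst, double_add_fst, double_add_snd, lie_add, coadR_add, add_coadR]
        abel)
    (by simp only [double_lie_snd, double_add_fst, double_add_snd, lie_add, coadL_add, add_coadL]
        abel)
  lie_self a := Double.ext
    (by rw [double_lie_fst, lie_self, zero_add, sub_self]; rfl)
    (by rw [double_lie_snd, lie_self, zero_add, sub_self]; rfl)
  leibniz_lie a b c := by
    have hR : ∀ (ξ η : B.Dual) (x : g), B.coadR ⁅ξ, η⁆ x
        = B.coadR ξ (B.coadR η x) - B.coadR η (B.coadR ξ x) := by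
      intro ξ η x
      apply B.apply_inj
      intro ζ
      simp only [map_sub, apply_coadR]
      rw [leibniz_lie ζ ξ η, lie_skew_dual B ξ ⁅ζ, η⁆]
      simp only [map_add, map_neg, LinearMap.add_apply, LinearMap.neg_apply]
      ring
    have hL : ∀ (x y : g) (ξ : B.Dual), B.coadL ⁅x, y⁆ ξ
        = B.coadL x (B.coadL y ξ) - B.coadL y (B.coadL x ξ) := by
      intro x y ξ
      refine dual_ext fun z => ?_
      simp only [map_sub, LinearMap.sub_apply, coadL_apply]
      rw [← map_sub, leibniz_lie z x y, ← lie_skew x ⁅z, y⁆, sub_eq_add_neg]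
    have hRl : ∀ (ξ : B.Dual) (x y : g), B.coadR ξ ⁅x, y⁆
        = ⁅x, B.coadR ξ y⁆ + ⁅B.coadR ξ x, y⁆
          + B.coadR (B.coadL y ξ) x - B.coadR (B.coadL x ξ) y := by
      intro ξ x y
      apply B.apply_inj
      intro ζ
      have h1 : B.ofDual ζ ⁅x, B.coadR ξ y⁆ = -B.ofDual ⁅B.coadL x ζ, ξ⁆ y := by
        rw [← apply_coadR, coadL_apply, ← map_neg, lie_skew]
      have h2 : B.ofDual ζ ⁅B.coadR ξ x, y⁆ = B.ofDual ⁅B.coadL y ζ, ξ⁆ x := by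
        rw [← apply_coadR, coadL_apply]
      simp only [map_add, map_sub, apply_coadR, lie_apply_lie, h1, h2]
      ring
    have hLl : ∀ (x : g) (ξ η : B.Dual), B.coadL x ⁅ξ, η⁆
        = ⁅ξ, B.coadL x η⁆ + ⁅B.coadL x ξ, η⁆
          + B.coadL (B.coadR η x) ξ - B.coadL (B.coadR ξ x) η := by
      intro x ξ η
      refine dual_ext fun y => ?_
      have h1 : B.ofDual ξ ⁅y, B.coadR η x⁆ = -B.ofDual ⁅B.coadL y ξ, η⁆ x := by
        rw [← apply_coadR, coadL_apply, ← map_neg, lie_skew]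
      have h2 : B.ofDual η ⁅y, B.coadR ξ x⁆ = -B.ofDual ⁅B.coadL y η, ξ⁆ x := by
        rw [← apply_coadR, coadL_apply, ← map_neg, lie_skew]
      simp only [map_add, map_sub, LinearMap.add_apply, LinearMap.sub_apply, coadL_apply,
        lie_apply_lie, h1, h2]
      linear_combination -B.lie_apply_skew (B.coadL y η) ξ x
    have aR : ∀ (ξ η : B.Dual) (x : g), B.coadR (ξ - η) x = B.coadR ξ x - B.coadR η x := by
      intro ξ η x
      rw [eq_sub_iff_add_eq, ← add_coadR, sub_add_cancel]
    have aL : ∀ (x y : g) (ξ : B.Dual), B.coadL (x - y) ξ = B.coadL x ξ - B.coadL y ξ := by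
      intro x y ξ
      rw [eq_sub_iff_add_eq, ← add_coadL, sub_add_cancel]
    apply Double.ext
    · simp only [double_lie_fst, double_lie_snd, double_add_fst]
      generalize a.1 = x, a.2 = ξ, b.1 = y, b.2 = η, c.1 = z, c.2 = ζ
      simp only [lie_add, lie_sub, add_lie, sub_lie, coadR_add, coadR_sub, add_coadR, aR, hR, hRl]
      rw [← lie_skew y (B.coadR ζ x), leibniz_lie x y z]
      abel
    · simp only [double_lie_fst, double_lie_snd, double_add_snd]
      generalize a.1 = x, a.2 = ξ, b.1 = y, b.2 = η, c.1 = z, c.2 = ζ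
      simp only [lie_add, lie_sub, add_lie, sub_lie, coadL_add, coadL_sub, add_coadL, aL, hL, hLl]
      rw [← lie_skew η (B.coadL z ξ), leibniz_lie ξ η ζ]
      abel

instance : LieAlgebra 𝕜 B.Double where
  lie_smul c a b := Double.ext
    (by simp only [double_lie_fst, double_smul_fst, double_smul_snd, lie_smul, coadR_smul,
          smul_coadR, smul_add, smul_sub])
    (by simp only [double_lie_snd, double_smul_fst, double_smul_snd, lie_smul, coadL_smul,
          smul_coadL, smul_add, smul_sub])

variable [FiniteDimensional 𝕜 g]

/-- The cobracket of the double: `δ_g` on `g` and `-δ_{g*}` on `g*`. -/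
def doubleCobracket : B.Double →ₗ[𝕜] B.Double ⊗[𝕜] B.Double :=
  TensorProduct.map B.inl B.inl ∘ₗ B.cobracket ∘ₗ LinearMap.fst 𝕜 g B.Dual
    - TensorProduct.map B.inr B.inr ∘ₗ B.dual.cobracket ∘ₗ LinearMap.snd 𝕜 g B.Dual

/-- The pairing `⟨a, (ξ, x)⟩ = ⟨ξ - x, a⟩_d` between `d` and `d' = g* ⊕ g`. -/
def doublePairing (z : B.Dual × g) : Module.Dual 𝕜 B.Double where
  toFun a := B.ofDual z.1 a.1 - B.ofDual a.2 z.2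
  map_add' a b := by
    simp only [double_add_fst, double_add_snd, map_add, LinearMap.add_apply]
    ring
  map_smul' c a := by
    simp only [double_smul_fst, double_smul_snd, map_smul, LinearMap.smul_apply, smul_eq_mul,
      RingHom.id_apply]
    ring

theorem doublePairing_apply (z : B.Dual × g) (a : B.Double) :
    B.doublePairing z a = B.ofDual z.1 a.1 - B.ofDual a.2 z.2 := rfl

theorem exists_doublePairing (f : Module.Dual 𝕜 B.Double) : ∃ z, B.doublePairing z = f := by
  obtain ⟨x, hx⟩ := B.exists_evalAt (f ∘ₗ B.inr)
  refine ⟨(B.toDual (f ∘ₗ B.inl), -x), LinearMap.ext fun a => ?_⟩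
  have ha : a = B.inl a.1 + B.inr a.2 :=
    Double.ext (add_zero a.1).symm (zero_add a.2).symm
  have h2 : B.ofDual a.2 x = f (B.inr a.2) := LinearMap.congr_fun hx a.2
  rw [doublePairing_apply, map_neg, h2, sub_neg_eq_add]
  conv_rhs => rw [ha, map_add]
  rfl

theorem tensorEval_doubleCobracket (z w : B.Dual × g) (a : B.Double) :
    tensorEval (B.doublePairing z) (B.doublePairing w) (B.doubleCobracket a)
      = B.doublePairing ⁅z, w⁆ a := by
  have h1 : ∀ z, B.doublePairing z ∘ₗ B.inl = B.ofDual z.1 := fun z => LinearMap.ext fun x => by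
    change B.ofDual z.1 x - B.ofDual 0 z.2 = _
    simp
  have h2 : ∀ z, B.doublePairing z ∘ₗ B.inr = B.evalAt (-z.2) := fun z => LinearMap.ext fun ξ => by
    change B.ofDual z.1 0 - B.ofDual ξ z.2 = _
    simp
  have h3 : B.doubleCobracket a = TensorProduct.map B.inl B.inl (B.cobracket a.1)
    - TensorProduct.map B.inr B.inr (B.dualCobracket a.2) := rfl
  rw [h3, map_sub, tensorEval_map, tensorEval_map, h1, h1, h2, h2, tensorEval_dualCobracket,
    neg_lie, lie_neg, neg_neg, ← lie_apply]
  rfl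

/-- The double Lie bialgebra of `g`. -/
def double : LieBialgebra 𝕜 B.Double where
  cobracket := B.doubleCobracket
  skew a := isSkew_iff.2 fun f h => by
    obtain ⟨z, rfl⟩ := B.exists_doublePairing f
    obtain ⟨w, rfl⟩ := B.exists_doublePairing h
    rw [tensorEval_doubleCobracket, tensorEval_doubleCobracket, ← lie_skew]
    simp only [doublePairing_apply, Prod.fst_neg, Prod.snd_neg, map_neg, LinearMap.neg_apply]
    ring
  coJacobi f h k := by
    obtain ⟨u, rfl⟩ := B.exists_doublePairing f
    obtain ⟨v, rfl⟩ := B.exists_doublePairing h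
    obtain ⟨w, rfl⟩ := B.exists_doublePairing k
    have hb : ∀ z w, dualBracket B.doubleCobracket (B.doublePairing z) (B.doublePairing w)
        = B.doublePairing ⁅z, w⁆ :=
      fun z w => LinearMap.ext fun a => B.tensorEval_doubleCobracket z w a
    rw [hb, hb, hb, hb, hb, hb]
    ext a
    have hadd : ∀ z w a, B.doublePairing z a + B.doublePairing w a = B.doublePairing (z + w) a := by
      intro z w a
      simp only [doublePairing_apply, Prod.fst_add, Prod.snd_add, map_add, LinearMap.add_apply]
      ring
    rw [LinearMap.add_apply, LinearMap.add_apply, hadd, hadd, lie_jacobi]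
    simp [doublePairing_apply]
  cocycle a b := tensor_ext fun f h => by
    obtain ⟨z, rfl⟩ := B.exists_doublePairing f
    obtain ⟨w, rfl⟩ := B.exists_doublePairing h
    have key : ∀ (a : B.Double) (z w : B.Dual × g) (t : B.Double ⊗[𝕜] B.Double),
        tensorEval (B.doublePairing z) (B.doublePairing w) ⁅a, t⁆
          = tensorEval (B.doublePairing z ∘ₗ LieAlgebra.ad 𝕜 B.Double a) (B.doublePairing w) t
            + tensorEval (B.doublePairing z) (B.doublePairing w ∘ₗ LieAlgebra.ad 𝕜 B.Double a) t := by
      intro a z w t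
      induction t with
      | zero => simp
      | tmul u v => simp [TensorProduct.LieModule.lie_tmul_right]
      | add s t hs ht => rw [lie_add]; simp only [map_add, hs, ht]; ring
    have hz : ∀ (a : B.Double) (z : B.Dual × g),
        B.doublePairing z ∘ₗ LieAlgebra.ad 𝕜 B.Double a
          = B.doublePairing (⁅z.1, a.2⁆ - B.coadL a.1 z.1 - B.coadL z.2 a.2,
            ⁅z.2, a.1⁆ - B.coadR z.1 a.1 - B.coadR a.2 z.2) := by
      intro a z
      refine LinearMap.ext fun b => ?_
      rw [LinearMap.comp_apply, LieAlgebra.ad_apply]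
      simp only [doublePairing_apply, double_lie_fst, double_lie_snd, map_add, map_sub,
        LinearMap.add_apply, LinearMap.sub_apply, apply_coadR, coadL_apply]
      linear_combination -B.lie_apply_skew a.2 b.2 z.2 + B.apply_lie_skew z.1 b.1 a.1
        - B.lie_apply_skew z.1 b.2 a.1 + B.apply_lie_skew a.2 b.1 z.2
    rw [map_sub, key, key, hz, hz, hz, hz]
    have h1 : ∀ (ξ η : B.Dual) (x y : g), B.ofDual η ⁅x, B.coadR ξ y⁆
        = -B.ofDual ⁅B.coadL x η, ξ⁆ y := by
      intro ξ η x y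
      rw [← apply_coadR, coadL_apply, ← map_neg, lie_skew]
    have h2 : ∀ (ξ η : B.Dual) (x y : g), B.ofDual η ⁅B.coadR ξ x, y⁆
        = B.ofDual ⁅B.coadL y η, ξ⁆ x := by
      intro ξ η x y
      rw [← apply_coadR, coadL_apply]
    simp only [tensorEval_doubleCobracket, doublePairing_apply, LieAlgebra.Prod.bracket_apply,
      double_lie_fst, double_lie_snd]
    generalize a.1 = x, a.2 = α, b.1 = y, b.2 = β, z.1 = ξ, z.2 = u, w.1 = ζ, w.2 = v
    simp only [lie_sub, sub_lie, map_add, map_sub, LinearMap.add_apply,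
      LinearMap.sub_apply, apply_coadR, lie_apply_lie, h1, h2]
    have j1 : ∀ (α : B.Dual) (x : g), B.ofDual ⁅⁅ξ, ζ⁆, α⁆ x
        = B.ofDual ⁅ξ, ⁅ζ, α⁆⁆ x + B.ofDual ⁅⁅ξ, α⁆, ζ⁆ x := by
      intro α x
      rw [lie_lie, lie_skew_dual B ⁅ξ, α⁆ ζ, map_sub, map_neg, LinearMap.sub_apply,
        LinearMap.neg_apply, sub_eq_add_neg]
    have j2 : ∀ (α : B.Dual) (x : g), B.ofDual (B.coadL x α) ⁅u, v⁆
        = B.ofDual α ⁅u, ⁅v, x⁆⁆ + B.ofDual α ⁅⁅u, x⁆, v⁆ := by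
      intro α x
      rw [coadL_apply, lie_lie, ← lie_skew ⁅u, x⁆ v, map_sub, map_neg, sub_eq_add_neg]
    simp only [j1, j2]
    linear_combination -B.lie_apply_skew α (B.coadL v β) u + B.lie_apply_skew α (B.coadL u β) v
      + B.lie_apply_skew ξ (B.coadL v α) y - B.lie_apply_skew ξ (B.coadL v β) x

/-- The pairing identifies the direct product Lie algebra `d' = g* ⊕ g` with the Lie algebra
dual to the double Lie bialgebra. -/
def doubleDualEquiv : (B.Dual × g) ≃ₗ⁅𝕜⁆ B.double.Dual where
  toFun z := B.double.toDual (B.doublePairing z)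
  map_add' z w := dual_ext fun a => by
    change B.doublePairing (z + w) a = B.doublePairing z a + B.doublePairing w a
    simp only [doublePairing_apply, Prod.fst_add, Prod.snd_add, map_add, LinearMap.add_apply]
    ring
  map_smul' c z := dual_ext fun a => by
    change B.doublePairing (c • z) a = c * B.doublePairing z a
    simp only [doublePairing_apply, Prod.smul_fst, Prod.smul_snd, map_smul, LinearMap.smul_apply,
      smul_eq_mul]
    ring
  map_lie' {z w} := dual_ext fun a => (B.tensorEval_doubleCobracket z w a).symm
  invFun f := (B.toDual (B.double.ofDual f ∘ₗ B.inl),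
    -(Module.evalEquiv 𝕜 g).symm (B.double.ofDual f ∘ₗ B.inr ∘ₗ B.toDual.toLinearMap))
  left_inv z := by
    refine Prod.ext (dual_ext fun x => ?_) (B.apply_inj fun ξ => ?_)
    · change B.ofDual z.1 x - B.ofDual 0 z.2 = _
      simp
    · rw [map_neg, neg_eq_iff_eq_neg]
      refine (Module.apply_evalEquiv_symm_apply 𝕜 g (B.ofDual ξ) _).trans ?_
      change B.ofDual z.1 0 - B.ofDual ξ z.2 = _
      simp
  right_inv f := dual_ext fun a => by
    have ha : a = B.inl a.1 + B.inr a.2 :=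
      Double.ext (add_zero a.1).symm (zero_add a.2).symm
    change B.double.ofDual f (B.inl a.1) - B.ofDual a.2 (-_) = _
    rw [map_neg, sub_neg_eq_add, Module.apply_evalEquiv_symm_apply]
    conv_rhs => rw [ha, map_add]
    rfl

end Double

section Transport

variable {𝕜 g h : Type*} [Field 𝕜] [LieRing g] [LieAlgebra 𝕜 g] [LieRing h] [LieAlgebra 𝕜 h]

/-- Transport of a Lie bialgebra structure along an isomorphism of Lie algebras. -/
def transport (B : LieBialgebra 𝕜 g) (e : h ≃ₗ⁅𝕜⁆ g) : LieBialgebra 𝕜 h where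
  cobracket := TensorProduct.map (e.symm : g →ₗ[𝕜] h) (e.symm : g →ₗ[𝕜] h) ∘ₗ B.cobracket ∘ₗ
    (e : h →ₗ[𝕜] g)
  skew x := isSkew_iff.2 fun ξ η => by
    simp only [LinearMap.comp_apply, tensorEval_map]
    exact isSkew_iff.1 (B.skew _) _ _
  coJacobi ξ η ζ := by
    have hb : ∀ ξ η : Module.Dual 𝕜 h,
        dualBracket (TensorProduct.map (e.symm : g →ₗ[𝕜] h) (e.symm : g →ₗ[𝕜] h) ∘ₗ
          B.cobracket ∘ₗ (e : h →ₗ[𝕜] g)) ξ η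
        = dualBracket B.cobracket (ξ ∘ₗ (e.symm : g →ₗ[𝕜] h)) (η ∘ₗ (e.symm : g →ₗ[𝕜] h)) ∘ₗ
          (e : h →ₗ[𝕜] g) := fun ξ η => LinearMap.ext fun x => by
      simp only [dualBracket, LinearMap.comp_apply, tensorEval_map]
    have hc : ∀ f : Module.Dual 𝕜 g, (f ∘ₗ (e : h →ₗ[𝕜] g)) ∘ₗ (e.symm : g →ₗ[𝕜] h) = f :=
      fun f => LinearMap.ext fun x => congrArg f (e.apply_symm_apply x)
    simp only [hb, hc, ← LinearMap.add_comp, B.coJacobi, LinearMap.zero_comp]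
  cocycle x y := by
    have key : ∀ (x : h) (t : g ⊗[𝕜] g),
        TensorProduct.map (e.symm : g →ₗ[𝕜] h) (e.symm : g →ₗ[𝕜] h) ⁅e x, t⁆
          = ⁅x, TensorProduct.map (e.symm : g →ₗ[𝕜] h) (e.symm : g →ₗ[𝕜] h) t⁆ := by
      intro x t
      induction t with
      | zero => simp
      | tmul u v =>
        have hl : ∀ u : g, e.symm ⁅e x, u⁆ = ⁅x, e.symm u⁆ := fun u => by
          rw [LieEquiv.map_lie, e.symm_apply_apply]
        simp [TensorProduct.LieModule.lie_tmul_right, hl]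
      | add s t hs ht => simp only [lie_add, map_add, hs, ht]
    have he : (e : h →ₗ[𝕜] g) ⁅x, y⁆ = ⁅e x, e y⁆ := LieEquiv.map_lie e x y
    simp only [LinearMap.comp_apply, he, B.cocycle, map_sub, key]
    rfl

end Transport

/-- The Lie bialgebra `d' = g* ⊕ g` dual to the double Lie bialgebra `d` of `g`, where `(ξ, x)` in
`d'` is the functional `a ↦ ⟨ξ - x, a⟩_d` on `d`. -/
def doubleDual {𝕜 g : Type*} [Field 𝕜] [CharZero 𝕜] [LieRing g] [LieAlgebra 𝕜 g]
    [FiniteDimensional 𝕜 g] (B : LieBialgebra 𝕜 g) : LieBialgebra 𝕜 (B.Dual × g) :=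
  B.double.dual.transport B.doubleDualEquiv

end LieBialgebra

/-! ### Bivector fields, Schouten brackets and Poisson actions on manifolds -/

section Manifold

variable {𝕜 : Type*} [RCLike 𝕜] {E : Type*} [NormedAddCommGroup E] [NormedSpace 𝕜 E]

/-- The Schouten bracket `[V, π]` of a vector field and a bivector field on the vector space `E`
at `y`, evaluated on the (constant) covectors `a` and `b`. -/
def schoutenVectorBivector (V : E → E) (π : E → E ⊗[𝕜] E) (y : E) (a b : Dual 𝕜 E) : 𝕜 :=
  fderiv 𝕜 (fun z => tensorEval a b (π z)) y (V y)
    - tensorEval (a ∘ₗ (fderiv 𝕜 V y : E →ₗ[𝕜] E)) b (π y)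
    - tensorEval a (b ∘ₗ (fderiv 𝕜 V y : E →ₗ[𝕜] E)) (π y)

/-- The Schouten bracket `[π, ϖ]` of two bivector fields on the vector space `E` at `y`, evaluated
on the (constant) covectors `a`, `b`, `c`. -/
def schoutenBivectors (π ϖ : E → E ⊗[𝕜] E) (y : E) (a b c : Dual 𝕜 E) : 𝕜 :=
  (fderiv 𝕜 (fun z => tensorEval b c (ϖ z)) y (sharp a (π y))
      + fderiv 𝕜 (fun z => tensorEval b c (π z)) y (sharp a (ϖ y)))
    + (fderiv 𝕜 (fun z => tensorEval c a (ϖ z)) y (sharp b (π y))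
      + fderiv 𝕜 (fun z => tensorEval c a (π z)) y (sharp b (ϖ y)))
    + (fderiv 𝕜 (fun z => tensorEval a b (ϖ z)) y (sharp c (π y))
      + fderiv 𝕜 (fun z => tensorEval a b (π z)) y (sharp c (ϖ y)))

variable {H : Type*} [TopologicalSpace H] (I : ModelWithCorners 𝕜 E H)
  {M : Type*} [TopologicalSpace M] [ChartedSpace H M]

/-- The expression of a vector field in the preferred chart at `p`. -/
def vectorInChart (V : Π p : M, TangentSpace I p) (p : M) (y : E) : E :=
  VectorField.mpullback 𝓘(𝕜, E) I (extChartAt I p).symm V y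

/-- The expression of a field of 2-tensors in the preferred chart at `p`. -/
def tensorInChart (π : Π p : M, TangentSpace I p ⊗[𝕜] TangentSpace I p) (p : M) (y : E) :
    E ⊗[𝕜] E :=
  let D : TangentSpace I ((extChartAt I p).symm y) →ₗ[𝕜] E :=
    (mfderiv 𝓘(𝕜, E) I (extChartAt I p).symm y).inverse.toLinearMap
  TensorProduct.map D D (π ((extChartAt I p).symm y))

/-- A covector at `p`, expressed in the preferred chart at `p`. -/
def covectorInChart (p : M) (α : Dual 𝕜 (TangentSpace I p)) : Dual 𝕜 E :=
  α ∘ₗ (mfderiv I 𝓘(𝕜, E) (extChartAt I p) p).inverse.toLinearMap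

/-- The Schouten bracket `[V, π]` of a vector field and a bivector field on a manifold without
boundary at the point `p`, evaluated on two covectors at `p`. -/
def mSchoutenVectorBivector (V : Π p : M, TangentSpace I p)
    (π : Π p : M, TangentSpace I p ⊗[𝕜] TangentSpace I p)
    (p : M) (α β : Dual 𝕜 (TangentSpace I p)) : 𝕜 :=
  schoutenVectorBivector (vectorInChart I V p) (tensorInChart I π p) (extChartAt I p p)
    (covectorInChart I p α) (covectorInChart I p β)

/-- The Schouten bracket `[π, ϖ]` of two bivector fields on a manifold without boundary at the
point `p`, evaluated on three covectors at `p`. -/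
def mSchoutenBivectors (π ϖ : Π p : M, TangentSpace I p ⊗[𝕜] TangentSpace I p)
    (p : M) (α β γ : Dual 𝕜 (TangentSpace I p)) : 𝕜 :=
  schoutenBivectors (tensorInChart I π p) (tensorInChart I ϖ p) (extChartAt I p p)
    (covectorInChart I p α) (covectorInChart I p β) (covectorInChart I p γ)

/-- Smooth (for `𝕜 = ℂ`: holomorphic) sections of `∧² TM`; smoothness is that of the components in
charts. -/
structure IsBivectorField (π : Π p : M, TangentSpace I p ⊗[𝕜] TangentSpace I p) : Prop where
  skew : ∀ p, IsSkew (π p)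
  smooth : ∀ (p : M) (a b : Dual 𝕜 E),
    ContDiffOn 𝕜 ∞ (fun y => tensorEval a b (tensorInChart I π p y)) (extChartAt I p).target

/-- Poisson structures: bivector fields `π` with `[π, π] = 0`. -/
structure IsPoissonStructure (π : Π p : M, TangentSpace I p ⊗[𝕜] TangentSpace I p) : Prop
    extends IsBivectorField I π where
  schouten_self : ∀ (p : M) (α β γ : Dual 𝕜 (TangentSpace I p)),
    mSchoutenBivectors I π π p α β γ = 0

variable {g : Type*} [LieRing g] [LieAlgebra 𝕜 g]

/-- The 2-tensor field `σ(t)` for `t ∈ g ⊗ g`, where `σ(x ⊗ y) = σ(x) ⊗ σ(y)`. -/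
def actionTensor (σ : g →ₗ[𝕜] Π p : M, TangentSpace I p) (t : g ⊗[𝕜] g) (p : M) :
    TangentSpace I p ⊗[𝕜] TangentSpace I p :=
  TensorProduct.map (LinearMap.proj p ∘ₗ σ) (LinearMap.proj p ∘ₗ σ) t

variable [IsManifold I ∞ M]

/-- `σ` is a right Poisson action of the Lie bialgebra `(g, δ)` on `(M, π)`: a Lie algebra
homomorphism into the smooth vector fields with `[σ(x), π] = σ(δ(x))`. -/
structure IsRightPoissonAction (B : LieBialgebra 𝕜 g)
    (π : Π p : M, TangentSpace I p ⊗[𝕜] TangentSpace I p)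
    (σ : g →ₗ[𝕜] Π p : M, TangentSpace I p) : Prop where
  smooth : ∀ x, ContMDiff I I.tangent ∞ (fun p => (⟨p, σ x p⟩ : TangentBundle I M))
  map_lie : ∀ x y p, σ ⁅x, y⁆ p = VectorField.mlieBracket I (σ x) (σ y) p
  schouten : ∀ x p (α β : Dual 𝕜 (TangentSpace I p)),
    mSchoutenVectorBivector I (σ x) π p α β
      = tensorEval α β (actionTensor I σ (B.cobracket x) p)

/-- `σ` is a left Poisson action of the Lie bialgebra `(g, δ)` on `(M, π)`: a Lie algebra
anti-homomorphism into the smooth vector fields with `[σ(x), π] = σ(δ(x))`. -/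
structure IsLeftPoissonAction (B : LieBialgebra 𝕜 g)
    (π : Π p : M, TangentSpace I p ⊗[𝕜] TangentSpace I p)
    (σ : g →ₗ[𝕜] Π p : M, TangentSpace I p) : Prop where
  smooth : ∀ x, ContMDiff I I.tangent ∞ (fun p => (⟨p, σ x p⟩ : TangentBundle I M))
  map_lie : ∀ x y p, σ ⁅x, y⁆ p = -VectorField.mlieBracket I (σ x) (σ y) p
  schouten : ∀ x p (α β : Dual 𝕜 (TangentSpace I p)),
    mSchoutenVectorBivector I (σ x) π p α β
      = tensorEval α β (actionTensor I σ (B.cobracket x) p)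

end Manifold

/-! ### The mixed product -/

section MixedProduct

variable {𝕜 : Type*} [RCLike 𝕜]
  {EX : Type*} [NormedAddCommGroup EX] [NormedSpace 𝕜 EX]
  {HX : Type*} [TopologicalSpace HX] (IX : ModelWithCorners 𝕜 EX HX)
  {X : Type*} [TopologicalSpace X] [ChartedSpace HX X]
  {EY : Type*} [NormedAddCommGroup EY] [NormedSpace 𝕜 EY]
  {HY : Type*} [TopologicalSpace HY] (IY : ModelWithCorners 𝕜 EY HY)
  {Y : Type*} [TopologicalSpace Y] [ChartedSpace HY Y]

/-- The inclusion `v ↦ (v, 0)` of `T_p X` into `T_(p,q) (X × Y)`. -/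
def tangentInl (z : X × Y) : TangentSpace IX z.1 →ₗ[𝕜] TangentSpace (IX.prod IY) z :=
  (mfderiv IX (IX.prod IY) (fun x : X => (x, z.2)) z.1 :)

/-- The inclusion `w ↦ (0, w)` of `T_q Y` into `T_(p,q) (X × Y)`. -/
def tangentInr (z : X × Y) : TangentSpace IY z.2 →ₗ[𝕜] TangentSpace (IX.prod IY) z :=
  (mfderiv IY (IX.prod IY) (fun y : Y => (z.1, y)) z.2 :)

variable {g : Type*} [LieRing g] [LieAlgebra 𝕜 g] {B : LieBialgebra 𝕜 g}

/-- The bivector field `(π_X, π_Y) - ∑ᵢ (ρ(ξᵢ), 0) ∧ (0, lam(xᵢ))` on `X × Y`, where `xᵢ` is the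
basis `b` of `g` and `ξᵢ` the dual basis of `g*`. -/
def mixedProduct {ι : Type*} [Fintype ι] (b : Basis ι 𝕜 g)
    (πX : Π p : X, TangentSpace IX p ⊗[𝕜] TangentSpace IX p)
    (πY : Π q : Y, TangentSpace IY q ⊗[𝕜] TangentSpace IY q)
    (ρ : B.Dual →ₗ[𝕜] Π p : X, TangentSpace IX p)
    (lam : g →ₗ[𝕜] Π q : Y, TangentSpace IY q)
    (z : X × Y) : TangentSpace (IX.prod IY) z ⊗[𝕜] TangentSpace (IX.prod IY) z :=
  TensorProduct.map (tangentInl IX IY z) (tangentInl IX IY z) (πX z.1)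
    + TensorProduct.map (tangentInr IX IY z) (tangentInr IX IY z) (πY z.2)
    - ∑ i, wedge (tangentInl IX IY z (ρ (B.toDual (b.coord i)) z.1))
        (tangentInr IX IY z (lam (b i) z.2))

/-- The map `(ξ, x) ↦ (ρ(ξ), 0) + (0, -lam(x))` from `d' = g* ⊕ g` to vector fields on `X × Y`. -/
def combinedAction (ρ : B.Dual →ₗ[𝕜] Π p : X, TangentSpace IX p)
    (lam : g →ₗ[𝕜] Π q : Y, TangentSpace IY q) :
    B.Dual × g →ₗ[𝕜] Π z : X × Y, TangentSpace (IX.prod IY) z where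
  toFun w z := tangentInl IX IY z (ρ w.1 z.1) + tangentInr IX IY z (-lam w.2 z.2)
  map_add' w w' := by
    funext z
    simp only [Prod.fst_add, Prod.snd_add, map_add, Pi.add_apply, neg_add]
    abel
  map_smul' c w := by
    funext z
    simp only [Prod.smul_fst, Prod.smul_snd, map_smul, Pi.smul_apply, smul_add, ← smul_neg,
      RingHom.id_apply]

end MixedProduct

end

/-! ### Evaluation, contraction and skewness of 2-tensors -/

section LinearAlgebra

variable {𝕜 : Type*} [Field 𝕜] {V W : Type*} [AddCommGroup V] [Module 𝕜 V]
  [AddCommGroup W] [Module 𝕜 W]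

/-! Apart from smoothness and skewness, every assertion is an identity at one point that involves
only values and first derivatives of the fields. `IsPoissonActionAt` collects these identities on a
vector space, with a constant `c` equal to `1` for right actions and `-1` for left ones. In a
product chart the mixed product becomes the same construction on a product of vector spaces, so the
theorem reduces to `IsPoissonActionAt.mixedTensorField`.

A covector `α` on the product determines `P` in `g` and `A` in `g*` by `α(ρ(η), 0) = ⟨η, P⟩` and
`α(0, lam(x)) = ⟨A, x⟩`. Sums over dual bases then collapse: with `a₁`, `a₂` the components of `α`,
the mixed product sends `α` to `(π₁♯a₁ + ρ(A), π₂♯a₂ - lam(P))`, and its derivatives involve only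
derivatives of `ρ` and `lam` at such elements.

Let `β`, `γ` have data `(Q, C)` and `(S, D)`. In the self-bracket of the mixed product, the
self-brackets of the factors vanish. The Poisson action identities convert the derivatives of `π₁`
along `ρ(A)` and of `π₂` along `lam(P)`; the derivatives of `ρ` and `lam` along `π₁♯`, `π₂♯` that
they produce cancel those coming from the mixed term. What remains is algebraic. The cobracket of
`g*` contributes `⟨A, [Q, S]⟩` and its cyclic images, which cancel the terms produced because `lam`
is an anti-homomorphism; the cobracket of `g` contributes `⟨[C, D], P⟩` and its cyclic images, which
cancel those produced because `ρ` is a homomorphism.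

For the combined action, `α` composed with the action is the functional on `d'` given by pairing
with `(P, A)` in the double `d`. The cobracket of `d'` is thus evaluated through the bracket `[(P,
A), (Q, C)]` of `d`, whose six terms come one by one from the two cobracket identities and four
instances of the (anti)homomorphism property. -/

theorem tensorEval_wedge (ξ η : Dual 𝕜 V) (u v : V) :
    tensorEval ξ η (wedge u v : V ⊗[𝕜] V) = ξ u * η v - ξ v * η u := by
  simp [wedge]

theorem sharp_map (f : V →ₗ[𝕜] W) (ξ : Dual 𝕜 W) (t : V ⊗[𝕜] V) :
    sharp ξ (TensorProduct.map f f t) = f (sharp (ξ ∘ₗ f) t) := by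
  induction t with
  | zero => simp
  | tmul u v => simp
  | add s t hs ht => simp [hs, ht]

theorem sharp_wedge (ξ : Dual 𝕜 V) (u v : V) :
    sharp ξ (wedge u v : V ⊗[𝕜] V) = ξ u • v - ξ v • u := by
  simp [wedge]

theorem IsSkew.map {t : V ⊗[𝕜] V} (h : IsSkew t) (f : V →ₗ[𝕜] W) :
    IsSkew (TensorProduct.map f f t) :=
  isSkew_iff.2 fun ξ η => by
    rw [tensorEval_map, tensorEval_map]
    exact isSkew_iff.1 h _ _

theorem isSkew_wedge (u v : V) : IsSkew (wedge u v : V ⊗[𝕜] V) := by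
  simp [IsSkew, wedge]

theorem IsSkew.add {s t : V ⊗[𝕜] V} (hs : IsSkew s) (ht : IsSkew t) : IsSkew (s + t) := by
  rw [IsSkew, map_add, hs, ht, neg_add]

theorem IsSkew.sub {s t : V ⊗[𝕜] V} (hs : IsSkew s) (ht : IsSkew t) : IsSkew (s - t) := by
  rw [IsSkew, map_sub, hs, ht, neg_sub, sub_neg_eq_add, neg_add_eq_sub]

theorem isSkew_sum {ι : Type*} (S : Finset ι) {t : ι → V ⊗[𝕜] V} (h : ∀ i, IsSkew (t i)) :
    IsSkew (∑ i ∈ S, t i) := by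
  rw [IsSkew, map_sum, ← Finset.sum_neg_distrib]
  exact Finset.sum_congr rfl fun i _ => h i

end LinearAlgebra

/-! ### The mixed product on a product of vector spaces: linear algebra -/

section FlatMixedProduct

variable {𝕜 : Type*} [Field 𝕜] {g : Type*} [LieRing g] [LieAlgebra 𝕜 g]
  {B : LieBialgebra 𝕜 g}
  {E F : Type*} [AddCommGroup E] [Module 𝕜 E] [AddCommGroup F] [Module 𝕜 F]

/-- The 2-tensor `(s, t) - ∑ᵢ (R(ξᵢ), 0) ∧ (0, L(xᵢ))` on a product of vector spaces. -/
noncomputable def mixedTensor {ι : Type*} [Fintype ι] (b : Basis ι 𝕜 g) (s : E ⊗[𝕜] E) (t : F ⊗[𝕜] F)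
    (R : B.Dual →ₗ[𝕜] E) (L : g →ₗ[𝕜] F) : (E × F) ⊗[𝕜] (E × F) :=
  TensorProduct.map (LinearMap.inl 𝕜 E F) (LinearMap.inl 𝕜 E F) s
    + TensorProduct.map (LinearMap.inr 𝕜 E F) (LinearMap.inr 𝕜 E F) t
    - ∑ i, wedge (LinearMap.inl 𝕜 E F (R (B.toDual (b.coord i)))) (LinearMap.inr 𝕜 E F (L (b i)))

variable {ι : Type*} [Fintype ι] (b : Basis ι 𝕜 g)

/-- Expansion of `A` in the dual basis. With its companion for `g`, this is where the choice of
basis disappears: sums over dual bases become values of `R` and `L` at single elements. -/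
theorem sum_apply_smul_toDual_coord {W : Type*} [AddCommGroup W] [Module 𝕜 W]
    (R : B.Dual →ₗ[𝕜] W) (A : B.Dual) :
    ∑ i, B.ofDual A (b i) • R (B.toDual (b.coord i)) = R A := by
  simp only [← map_smul, ← map_sum]
  congr 1
  rw [Basis.sum_dual_apply_smul_coord]
  rfl

theorem sum_coord_smul_apply {W : Type*} [AddCommGroup W] [Module 𝕜 W]
    (L : g →ₗ[𝕜] W) (P : g) : ∑ i, b.coord i P • L (b i) = L P := by
  simp only [← map_smul, ← map_sum, Basis.coord_apply, b.sum_repr]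

theorem tensorEval_mixedTensor (s : E ⊗[𝕜] E) (t : F ⊗[𝕜] F)
    (R : B.Dual →ₗ[𝕜] E) (L : g →ₗ[𝕜] F) (α β : Dual 𝕜 (E × F)) :
    tensorEval α β (mixedTensor b s t R L)
      = tensorEval (α ∘ₗ LinearMap.inl 𝕜 E F) (β ∘ₗ LinearMap.inl 𝕜 E F) s
        + tensorEval (α ∘ₗ LinearMap.inr 𝕜 E F) (β ∘ₗ LinearMap.inr 𝕜 E F) t
        - ∑ i, (α (R (B.toDual (b.coord i)), 0) * β (0, L (b i))
          - α (0, L (b i)) * β (R (B.toDual (b.coord i)), 0)) := by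
  simp only [mixedTensor, map_sub, map_add, map_sum, tensorEval_map, tensorEval_wedge,
    LinearMap.inl_apply, LinearMap.inr_apply]

theorem isSkew_mixedTensor {s : E ⊗[𝕜] E} {t : F ⊗[𝕜] F} (hs : IsSkew s) (ht : IsSkew t)
    (R : B.Dual →ₗ[𝕜] E) (L : g →ₗ[𝕜] F) : IsSkew (mixedTensor b s t R L) :=
  ((hs.map _).add (ht.map _)).sub (isSkew_sum _ fun _ => isSkew_wedge _ _)

/-- The element `P` of `g` with `η(P) = a(R(η))`. -/
theorem exists_apply_eq_comp [CharZero 𝕜] [FiniteDimensional 𝕜 g] (R : B.Dual →ₗ[𝕜] E)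
    (a : Dual 𝕜 E) : ∃ P : g, ∀ η : B.Dual, a (R η) = B.ofDual η P := by
  obtain ⟨P, hP⟩ := B.exists_evalAt (a ∘ₗ R)
  exact ⟨P, fun η => (LinearMap.congr_fun hP η).symm⟩

variable (s : E ⊗[𝕜] E) (t : F ⊗[𝕜] F) (R : B.Dual →ₗ[𝕜] E) (L : g →ₗ[𝕜] F)
  (α : Dual 𝕜 (E × F))

theorem sharp_mixedTensor {P : g} (hP : ∀ η, α (R η, 0) = B.ofDual η P) {A : B.Dual}
    (hA : ∀ x, α (0, L x) = B.ofDual A x) :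
    sharp α (mixedTensor b s t R L)
      = (sharp (α ∘ₗ LinearMap.inl 𝕜 E F) s + R A,
        sharp (α ∘ₗ LinearMap.inr 𝕜 E F) t - L P) := by
  simp only [mixedTensor, map_sub, map_add, map_sum, sharp_map, sharp_wedge]
  rw [← sum_apply_smul_toDual_coord b R, ← sum_coord_smul_apply b L P]
  simp only [LinearMap.inl_apply, LinearMap.inr_apply, hP, hA]
  refine Prod.ext ?_ ?_ <;> simp [Prod.fst_sum, Prod.snd_sum]

end FlatMixedProduct

/-! ### Poisson actions and the mixed product on vector spaces: first-order calculus -/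

section FlatCalculus

variable {𝕜 : Type*} [RCLike 𝕜] {g : Type*} [LieRing g] [LieAlgebra 𝕜 g] {B : LieBialgebra 𝕜 g}
  {E F : Type*} [NormedAddCommGroup E] [NormedSpace 𝕜 E] [NormedAddCommGroup F] [NormedSpace 𝕜 F]

/-- The derivative at `u` in the direction `v` of a linear family of functions differentiable
at `u`. -/
noncomputable def directionalDerivative {W : Type*} [AddCommGroup W] [Module 𝕜 W] (σ : W →ₗ[𝕜] E → E) (u : E)
    (hσ : ∀ w, DifferentiableAt 𝕜 (σ w) u) (v : E) : W →ₗ[𝕜] E where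
  toFun w := fderiv 𝕜 (σ w) u v
  map_add' w w' := by rw [map_add, fderiv_add (hσ w) (hσ w')]; rfl
  map_smul' c w := by rw [map_smul, fderiv_const_smul (hσ w)]; rfl

/-- A pointwise mixed product of tensor fields on a product of vector spaces. -/
noncomputable def mixedTensorField {ι : Type*} [Fintype ι] (b : Basis ι 𝕜 g) (π₁ : E → E ⊗[𝕜] E)
    (π₂ : F → F ⊗[𝕜] F) (ρ : B.Dual →ₗ[𝕜] E → E) (lam : g →ₗ[𝕜] F → F) (y : E × F) :
    (E × F) ⊗[𝕜] (E × F) :=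
  mixedTensor b (π₁ y.1) (π₂ y.2) (LinearMap.proj y.1 ∘ₗ ρ) (LinearMap.proj y.2 ∘ₗ lam)

variable [FiniteDimensional 𝕜 E] [FiniteDimensional 𝕜 F]
  {ι : Type*} [Fintype ι] (b : Basis ι 𝕜 g)
  {π₁ : E → E ⊗[𝕜] E} {π₂ : F → F ⊗[𝕜] F} {ρ : B.Dual →ₗ[𝕜] E → E} {lam : g →ₗ[𝕜] F → F}
  {y : E × F}

theorem DifferentiableAt.linearMap_comp {G : Type*} [NormedAddCommGroup G] [NormedSpace 𝕜 G]
    {V : G → E} {u : G} (hV : DifferentiableAt 𝕜 V u) (a : Dual 𝕜 E) :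
    DifferentiableAt 𝕜 (fun z => a (V z)) u :=
  (LinearMap.toContinuousLinearMap a).differentiableAt.comp u hV

theorem fderiv_linearMap_comp {G : Type*} [NormedAddCommGroup G] [NormedSpace 𝕜 G]
    {V : G → E} {u : G} (hV : DifferentiableAt 𝕜 V u) (a : Dual 𝕜 E) (v : G) :
    fderiv 𝕜 (fun z => a (V z)) u v = a (fderiv 𝕜 V u v) := by
  have := (LinearMap.toContinuousLinearMap a).hasFDerivAt.comp u hV.hasFDerivAt
  exact congrArg (fun f : G →L[𝕜] 𝕜 => f v) this.fderiv

/-- By the product rule, each term of the mixed sum has one differentiated factor and one evaluated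
at `y`. The latter is a coordinate of one of the fixed elements `P`, `Q`, `C`, `D`, so the sum
reassembles into the derivative of `ρ` or `lam` at that element. -/
theorem fderiv_tensorEval_mixedTensorField
    (hπ₁ : ∀ a c, DifferentiableAt 𝕜 (fun z => tensorEval a c (π₁ z)) y.1)
    (hπ₂ : ∀ a c, DifferentiableAt 𝕜 (fun z => tensorEval a c (π₂ z)) y.2)
    (hρ : ∀ ξ, DifferentiableAt 𝕜 (ρ ξ) y.1) (hlam : ∀ x, DifferentiableAt 𝕜 (lam x) y.2)
    (α β : Dual 𝕜 (E × F)) {P Q : g} (hP : ∀ η, α (ρ η y.1, 0) = B.ofDual η P)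
    (hQ : ∀ η, β (ρ η y.1, 0) = B.ofDual η Q) {C D : B.Dual}
    (hC : ∀ x, α (0, lam x y.2) = B.ofDual C x) (hD : ∀ x, β (0, lam x y.2) = B.ofDual D x)
    (v : E) (w : F) :
    fderiv 𝕜 (fun z => tensorEval α β (mixedTensorField b π₁ π₂ ρ lam z)) y (v, w)
      = fderiv 𝕜 (fun z => tensorEval (α ∘ₗ LinearMap.inl 𝕜 E F) (β ∘ₗ LinearMap.inl 𝕜 E F)
            (π₁ z)) y.1 v
        + fderiv 𝕜 (fun z => tensorEval (α ∘ₗ LinearMap.inr 𝕜 E F) (β ∘ₗ LinearMap.inr 𝕜 E F)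
            (π₂ z)) y.2 w
        - ((α ∘ₗ LinearMap.inl 𝕜 E F) (fderiv 𝕜 (ρ D) y.1 v)
          + (β ∘ₗ LinearMap.inr 𝕜 E F) (fderiv 𝕜 (lam P) y.2 w)
          - (β ∘ₗ LinearMap.inl 𝕜 E F) (fderiv 𝕜 (ρ C) y.1 v)
          - (α ∘ₗ LinearMap.inr 𝕜 E F) (fderiv 𝕜 (lam Q) y.2 w)) := by
  have hfst : HasFDerivAt (Prod.fst : E × F → E) (ContinuousLinearMap.fst 𝕜 E F) y :=
    hasFDerivAt_fst
  have hsnd : HasFDerivAt (Prod.snd : E × F → F) (ContinuousLinearMap.snd 𝕜 E F) y :=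
    hasFDerivAt_snd
  have h1 := fun α (ξ : B.Dual) =>
    ((hρ ξ).linearMap_comp (α ∘ₗ LinearMap.inl 𝕜 E F)).hasFDerivAt.comp y hfst
  have h2 := fun α (x : g) =>
    ((hlam x).linearMap_comp (α ∘ₗ LinearMap.inr 𝕜 E F)).hasFDerivAt.comp y hsnd
  have hs := HasFDerivAt.fun_sum (u := Finset.univ) fun i _ =>
    ((h1 α (B.toDual (b.coord i))).mul (h2 β (b i))).sub
      ((h2 α (b i)).mul (h1 β (B.toDual (b.coord i))))
  have h := (((hπ₁ (α ∘ₗ LinearMap.inl 𝕜 E F) (β ∘ₗ LinearMap.inl 𝕜 E F)).hasFDerivAt.comp y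
    hfst).add ((hπ₂ (α ∘ₗ LinearMap.inr 𝕜 E F) (β ∘ₗ LinearMap.inr 𝕜 E F)).hasFDerivAt.comp y
    hsnd)).sub hs
  have he : (fun z => tensorEval α β (mixedTensorField b π₁ π₂ ρ lam z)) = _ :=
    funext fun z => tensorEval_mixedTensor b _ _ _ _ α β
  rw [he]
  refine (congrArg (fun f : E × F →L[𝕜] 𝕜 => f (v, w)) h.fderiv).trans ?_
  -- The directional derivative of `ρ ξ` is linear in `ξ`, and that of `lam x` in `x`, so the basis
  -- expansions apply to them as well.
  have e1 := fun α : Dual 𝕜 (E × F) => fun D : B.Dual => sum_apply_smul_toDual_coord b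
    ((α ∘ₗ LinearMap.inl 𝕜 E F) ∘ₗ directionalDerivative ρ y.1 hρ v) D
  have e2 := fun α : Dual 𝕜 (E × F) => fun P : g => sum_coord_smul_apply b
    ((α ∘ₗ LinearMap.inr 𝕜 E F) ∘ₗ directionalDerivative lam y.2 hlam w) P
  have e1a := e1 α D
  have e1b := e1 β C
  have e2a := e2 β P
  have e2b := e2 α Q
  simp only [LinearMap.comp_apply, directionalDerivative, LinearMap.coe_mk, AddHom.coe_mk,
    LinearMap.inl_apply, LinearMap.inr_apply, smul_eq_mul] at e1a e1b e2a e2b ⊢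
  rw [← e1a, ← e1b, ← e2a, ← e2b]
  have f1 : ∀ (α : Dual 𝕜 (E × F)) ξ, fderiv 𝕜 (fun z => α (ρ ξ z, 0)) y.1 v
      = α (fderiv 𝕜 (ρ ξ) y.1 v, 0) := fun α ξ =>
    fderiv_linearMap_comp (hρ ξ) (α ∘ₗ LinearMap.inl 𝕜 E F) v
  have f2 : ∀ (α : Dual 𝕜 (E × F)) x, fderiv 𝕜 (fun z => α (0, lam x z)) y.2 w
      = α (0, fderiv 𝕜 (lam x) y.2 w) := fun α x =>
    fderiv_linearMap_comp (hlam x) (α ∘ₗ LinearMap.inr 𝕜 E F) w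
  simp only [Function.comp_apply,
    sub_apply, add_apply, sum_apply,
    smul_apply, ContinuousLinearMap.comp_apply, ContinuousLinearMap.coe_fst',
    ContinuousLinearMap.coe_snd', smul_eq_mul, f1, f2, hP, hQ, hC, hD, Finset.sum_add_distrib,
    Finset.sum_sub_distrib, B.ofDual_toDual]
  ring

/-- The data at a point `u` of a vector space of a Poisson structure `π` with an action `σ` of a Lie
bialgebra satisfying `[σ(x), π] = σ(δ(x))` and `σ[x, y] = c [σ(x), σ(y)]`. -/
structure IsPoissonActionAt {h : Type*} [LieRing h] [LieAlgebra 𝕜 h] (B : LieBialgebra 𝕜 h) (c : 𝕜)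
    (π : E → E ⊗[𝕜] E) (σ : h →ₗ[𝕜] E → E) (u : E) : Prop where
  skew : IsSkew (π u)
  differentiableAt_tensor : ∀ a b, DifferentiableAt 𝕜 (fun z => tensorEval a b (π z)) u
  schouten_self : ∀ a b c, schoutenBivectors π π u a b c = 0
  differentiableAt : ∀ x, DifferentiableAt 𝕜 (σ x) u
  map_lie : ∀ x y, σ ⁅x, y⁆ u = c • VectorField.lieBracket 𝕜 (σ x) (σ y) u
  schouten : ∀ x a b, schoutenVectorBivector (σ x) π u a b
    = tensorEval (a ∘ₗ LinearMap.proj u ∘ₗ σ) (b ∘ₗ LinearMap.proj u ∘ₗ σ) (B.cobracket x)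

/-- The map `(ξ, x) ↦ (ρ(ξ), -lam(x))` into vector fields on a product of vector spaces. -/
def combinedField (ρ : B.Dual →ₗ[𝕜] E → E) (lam : g →ₗ[𝕜] F → F) :
    B.Dual × g →ₗ[𝕜] E × F → E × F where
  toFun w z := (ρ w.1 z.1, -lam w.2 z.2)
  map_add' w w' := by
    funext z
    simp [add_comm]
  map_smul' c w := by
    funext z
    simp

variable [FiniteDimensional 𝕜 g]

theorem doublePairing_lie (w : B.Dual × g) (a b : B.Double) :
    B.doublePairing w ⁅a, b⁆
      = B.ofDual w.1 ⁅a.1, b.1⁆ + B.ofDual ⁅w.1, a.2⁆ b.1 - B.ofDual ⁅w.1, b.2⁆ a.1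
        - (B.ofDual ⁅a.2, b.2⁆ w.2 + B.ofDual b.2 ⁅w.2, a.1⁆ - B.ofDual a.2 ⁅w.2, b.1⁆) := by
  simp only [B.doublePairing_apply, B.double_lie_fst, B.double_lie_snd, map_add, map_sub,
    LinearMap.add_apply, LinearMap.sub_apply, B.apply_coadR, B.coadL_apply]

/-- The cobracket of `d'` is dual to the bracket of `d`; what has to be checked is that, after
transport along `doubleDualEquiv`, the functionals `φ` and `ψ` are the evaluations at `a` and `b`.
-/
theorem tensorEval_doubleDual_cobracket (φ ψ : Dual 𝕜 (B.Dual × g)) (a b : B.Double)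
    (hφ : ∀ z, φ z = B.doublePairing z a) (hψ : ∀ z, ψ z = B.doublePairing z b)
    (w : B.Dual × g) :
    tensorEval φ ψ (B.doubleDual.cobracket w) = B.doublePairing w ⁅a, b⁆ := by
  have h : ∀ (φ : Dual 𝕜 (B.Dual × g)) (a : B.Double), (∀ z, φ z = B.doublePairing z a) →
      φ ∘ₗ (B.doubleDualEquiv.symm : B.double.Dual →ₗ[𝕜] B.Dual × g) = B.double.evalAt a := by
    intro φ a hφ
    refine LinearMap.ext fun f => ?_
    obtain ⟨z, rfl⟩ := B.doubleDualEquiv.surjective f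
    refine (congrArg φ (B.doubleDualEquiv.symm_apply_apply z)).trans (hφ z)
  refine (tensorEval_map _ _ _ _).trans ?_
  rw [h φ a hφ, h ψ b hψ]
  exact B.double.tensorEval_dualCobracket a b _

/-- The identity `[σ(x), π] = σ(δ(x))` solved for the derivative of `π` along `σ(x)`. Skewness of
`π` turns the term with the derivative of `σ(x)` in the first slot into a value on `π♯b`. -/
theorem IsPoissonActionAt.fderiv_apply {h : Type*} [LieRing h] [LieAlgebra 𝕜 h]
    {B : LieBialgebra 𝕜 h} {c : 𝕜} {π : E → E ⊗[𝕜] E} {σ : h →ₗ[𝕜] E → E} {u : E}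
    (H : IsPoissonActionAt B c π σ u) (x : h) (a b : Dual 𝕜 E) :
    fderiv 𝕜 (fun z => tensorEval a b (π z)) u (σ x u)
      = b (fderiv 𝕜 (σ x) u (sharp a (π u))) - a (fderiv 𝕜 (σ x) u (sharp b (π u)))
        + tensorEval (a ∘ₗ LinearMap.proj u ∘ₗ σ) (b ∘ₗ LinearMap.proj u ∘ₗ σ)
          (B.cobracket x) := by
  have h1 := H.schouten x a b
  rw [schoutenVectorBivector, isSkew_iff.1 H.skew (a ∘ₗ _)] at h1
  simp only [tensorEval, LinearMap.comp_apply, ContinuousLinearMap.coe_coe] at h1 ⊢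
  linear_combination h1

theorem IsPoissonActionAt.apply_map_lie {h : Type*} [LieRing h] [LieAlgebra 𝕜 h]
    {B : LieBialgebra 𝕜 h} {c : 𝕜} {π : E → E ⊗[𝕜] E} {σ : h →ₗ[𝕜] E → E} {u : E}
    (H : IsPoissonActionAt B c π σ u) (x y : h) (a : Dual 𝕜 E) :
    a (σ ⁅x, y⁆ u) = c * (a (fderiv 𝕜 (σ y) u (σ x u)) - a (fderiv 𝕜 (σ x) u (σ y u))) := by
  rw [H.map_lie, VectorField.lieBracket, map_smul, map_sub, smul_eq_mul]

theorem IsPoissonActionAt.fderiv_apply_dual {π : E → E ⊗[𝕜] E} {c : 𝕜} {u : E}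
    {ρ : B.Dual →ₗ[𝕜] E → E} (H : IsPoissonActionAt B.dual c π ρ u) (ξ : B.Dual) (a b : Dual 𝕜 E)
    {P Q : g} (hP : ∀ η, a (ρ η u) = B.ofDual η P) (hQ : ∀ η, b (ρ η u) = B.ofDual η Q) :
    fderiv 𝕜 (fun z => tensorEval a b (π z)) u (ρ ξ u)
      = b (fderiv 𝕜 (ρ ξ) u (sharp a (π u))) - a (fderiv 𝕜 (ρ ξ) u (sharp b (π u)))
        + B.ofDual ξ ⁅P, Q⁆ := by
  rw [H.fderiv_apply, ← B.tensorEval_dualCobracket]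
  have h1 : a ∘ₗ LinearMap.proj u ∘ₗ ρ = B.evalAt P := LinearMap.ext hP
  have h2 : b ∘ₗ LinearMap.proj u ∘ₗ ρ = B.evalAt Q := LinearMap.ext hQ
  rw [h1, h2]
  rfl

omit [FiniteDimensional 𝕜 g] in
theorem IsPoissonActionAt.fderiv_apply_lie {π : E → E ⊗[𝕜] E} {c : 𝕜} {u : E}
    {lam : g →ₗ[𝕜] E → E} (H : IsPoissonActionAt B c π lam u) (x : g) (a b : Dual 𝕜 E)
    {A C : B.Dual} (hA : ∀ x, a (lam x u) = B.ofDual A x) (hC : ∀ x, b (lam x u) = B.ofDual C x) :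
    fderiv 𝕜 (fun z => tensorEval a b (π z)) u (lam x u)
      = b (fderiv 𝕜 (lam x) u (sharp a (π u))) - a (fderiv 𝕜 (lam x) u (sharp b (π u)))
        + B.ofDual ⁅A, C⁆ x := by
  rw [H.fderiv_apply, B.lie_apply]
  have h1 : a ∘ₗ LinearMap.proj u ∘ₗ lam = B.ofDual A := LinearMap.ext hA
  have h2 : b ∘ₗ LinearMap.proj u ∘ₗ lam = B.ofDual C := LinearMap.ext hC
  rw [h1, h2]

/-- `P` and `A` are the images of `α` under the transposes of `ρ` and `lam` at `y`. Finite dimension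
of `g` is what makes the functional on `g*` an evaluation at some `P`. -/
theorem exists_covector_data (ρ : B.Dual →ₗ[𝕜] E → E) (lam : g →ₗ[𝕜] F → F) (y : E × F)
    (α : Dual 𝕜 (E × F)) :
    ∃ (P : g) (A : B.Dual), (∀ η, α (ρ η y.1, 0) = B.ofDual η P) ∧
      (∀ x, α (0, lam x y.2) = B.ofDual A x) := by
  obtain ⟨P, hP⟩ := exists_apply_eq_comp
    ((LinearMap.proj y.1 : (E → E) →ₗ[𝕜] E) ∘ₗ ρ) (α ∘ₗ LinearMap.inl 𝕜 E F)
  exact ⟨P, B.toDual ((α ∘ₗ LinearMap.inr 𝕜 E F) ∘ₗ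
    (LinearMap.proj y.2 : (F → F) →ₗ[𝕜] F) ∘ₗ lam), hP, fun x => rfl⟩

theorem sharp_mixedTensorField (α : Dual 𝕜 (E × F)) {P : g} {A : B.Dual}
    (hP : ∀ η, α (ρ η y.1, 0) = B.ofDual η P) (hA : ∀ x, α (0, lam x y.2) = B.ofDual A x) :
    sharp α (mixedTensorField b π₁ π₂ ρ lam y)
      = (sharp (α ∘ₗ LinearMap.inl 𝕜 E F) (π₁ y.1) + ρ A y.1,
        sharp (α ∘ₗ LinearMap.inr 𝕜 E F) (π₂ y.2) - lam P y.2) :=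
  sharp_mixedTensor b (π₁ y.1) (π₂ y.2) ((LinearMap.proj y.1 : (E → E) →ₗ[𝕜] E) ∘ₗ ρ)
    ((LinearMap.proj y.2 : (F → F) →ₗ[𝕜] F) ∘ₗ lam) α hP hA

/-- The cobracket on one side is dual to the bracket on the other: the failure of `π₁` to be
invariant under `ρ` is cancelled by the commutators of `lam`, and the failure of `π₂` under `lam` by
the commutators of `ρ`. -/
theorem schoutenBivectors_mixedTensorField (h₁ : IsPoissonActionAt B.dual 1 π₁ ρ y.1)
    (h₂ : IsPoissonActionAt B (-1) π₂ lam y.2) (α β γ : Dual 𝕜 (E × F)) :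
    schoutenBivectors (mixedTensorField b π₁ π₂ ρ lam) (mixedTensorField b π₁ π₂ ρ lam) y α β γ
      = 0 := by
  obtain ⟨P, A, hP, hA⟩ := exists_covector_data ρ lam y α
  obtain ⟨Q, C, hQ, hC⟩ := exists_covector_data ρ lam y β
  obtain ⟨S, D, hS, hD⟩ := exists_covector_data ρ lam y γ
  have hf := @fderiv_tensorEval_mixedTensorField 𝕜 _ g _ _ B E F _ _ _ _ _ _ ι _ b π₁ π₂ ρ lam y
    h₁.differentiableAt_tensor h₂.differentiableAt_tensor h₁.differentiableAt h₂.differentiableAt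
  rw [schoutenBivectors, sharp_mixedTensorField b α hP hA,
    sharp_mixedTensorField b β hQ hC, sharp_mixedTensorField b γ hS hD, hf α β hP hQ hA hC,
    hf β γ hQ hS hC hD, hf γ α hS hP hD hA]
  have s1 := h₁.schouten_self (α ∘ₗ LinearMap.inl 𝕜 E F) (β ∘ₗ LinearMap.inl 𝕜 E F)
    (γ ∘ₗ LinearMap.inl 𝕜 E F)
  have s2 := h₂.schouten_self (α ∘ₗ LinearMap.inr 𝕜 E F) (β ∘ₗ LinearMap.inr 𝕜 E F)
    (γ ∘ₗ LinearMap.inr 𝕜 E F)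
  have hP' : ∀ η, (α ∘ₗ LinearMap.inl 𝕜 E F) (ρ η y.1) = B.ofDual η P := hP
  have hQ' : ∀ η, (β ∘ₗ LinearMap.inl 𝕜 E F) (ρ η y.1) = B.ofDual η Q := hQ
  have hS' : ∀ η, (γ ∘ₗ LinearMap.inl 𝕜 E F) (ρ η y.1) = B.ofDual η S := hS
  have hA' : ∀ x, (α ∘ₗ LinearMap.inr 𝕜 E F) (lam x y.2) = B.ofDual A x := hA
  have hC' : ∀ x, (β ∘ₗ LinearMap.inr 𝕜 E F) (lam x y.2) = B.ofDual C x := hC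
  have hD' : ∀ x, (γ ∘ₗ LinearMap.inr 𝕜 E F) (lam x y.2) = B.ofDual D x := hD
  rw [schoutenBivectors] at s1 s2
  -- From here on the components of a covector on the two factors are linked to `ρ` and `lam` only
  -- through `P`, `Q`, `S`, `A`, `C`, `D`.
  generalize α ∘ₗ LinearMap.inl 𝕜 E F = a₁, α ∘ₗ LinearMap.inr 𝕜 E F = a₂,
    β ∘ₗ LinearMap.inl 𝕜 E F = b₁, β ∘ₗ LinearMap.inr 𝕜 E F = b₂,
    γ ∘ₗ LinearMap.inl 𝕜 E F = c₁, γ ∘ₗ LinearMap.inr 𝕜 E F = c₂ at *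
  have l1 := h₁.apply_map_lie A C c₁
  have l2 := h₁.apply_map_lie C D a₁
  have l3 := h₁.apply_map_lie D A b₁
  have l4 := h₂.apply_map_lie P Q c₂
  have l5 := h₂.apply_map_lie Q S a₂
  have l6 := h₂.apply_map_lie S P b₂
  rw [hS'] at l1
  rw [hP'] at l2
  rw [hQ'] at l3
  rw [hD'] at l4
  rw [hA'] at l5
  rw [hC'] at l6
  simp only [map_add, map_sub]
  -- The factor 2 appears because the bracket is symmetric in its two arguments, so for equal
  -- arguments each derivative is counted twice.
  linear_combination s1 + s2 + 2 * (h₁.fderiv_apply_dual A b₁ c₁ hQ' hS'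
    + h₁.fderiv_apply_dual C c₁ a₁ hS' hP' + h₁.fderiv_apply_dual D a₁ b₁ hP' hQ'
    - h₂.fderiv_apply_lie P b₂ c₂ hC' hD' - h₂.fderiv_apply_lie Q c₂ a₂ hD' hA'
    - h₂.fderiv_apply_lie S a₂ b₂ hA' hC' - l1 - l2 - l3 + l4 + l5 + l6)

theorem hasFDerivAt_combinedField (hρ : ∀ ξ, DifferentiableAt 𝕜 (ρ ξ) y.1)
    (hlam : ∀ x, DifferentiableAt 𝕜 (lam x) y.2) (w : B.Dual × g) :
    HasFDerivAt (combinedField ρ lam w)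
      ((fderiv 𝕜 (ρ w.1) y.1).prodMap (-fderiv 𝕜 (lam w.2) y.2)) y :=
  (hρ w.1).hasFDerivAt.prodMap y (hlam w.2).hasFDerivAt.neg

/-- Both sides reduce to the bracket of `(P, A)` and `(Q, C)` in the double, paired with `w`. Its
two unmixed terms come from the cobrackets of `g*` and `g`, its four coadjoint terms from the
brackets of `ρ(w.1)` with `ρ(A)`, `ρ(C)` and of `lam(w.2)` with `lam(P)`, `lam(Q)`. -/
theorem schoutenVectorBivector_combinedField (h₁ : IsPoissonActionAt B.dual 1 π₁ ρ y.1)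
    (h₂ : IsPoissonActionAt B (-1) π₂ lam y.2) (w : B.Dual × g) (α β : Dual 𝕜 (E × F)) :
    schoutenVectorBivector (combinedField ρ lam w) (mixedTensorField b π₁ π₂ ρ lam) y α β
      = tensorEval (α ∘ₗ LinearMap.proj y ∘ₗ combinedField ρ lam)
        (β ∘ₗ LinearMap.proj y ∘ₗ combinedField ρ lam) (B.doubleDual.cobracket w) := by
  obtain ⟨P, A, hP, hA⟩ := exists_covector_data ρ lam y α
  obtain ⟨Q, C, hQ, hC⟩ := exists_covector_data ρ lam y β
  -- The sign in `-lam` matches the sign in the pairing `⟨ξ - x, a⟩` of `d'` with `d`.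
  have hφ : ∀ (α : Dual 𝕜 (E × F)) {P : g} {A : B.Dual} (_ : ∀ η, α (ρ η y.1, 0) = B.ofDual η P)
      (_ : ∀ x, α (0, lam x y.2) = B.ofDual A x) (z : B.Dual × g),
      (α ∘ₗ LinearMap.proj y ∘ₗ combinedField ρ lam) z = B.doublePairing z ((P, A) : B.Double) := by
    intro α P A hP hA z
    have h : combinedField ρ lam z y = (ρ z.1 y.1, 0) - (0, lam z.2 y.2) := by
      simp [combinedField]
    rw [LinearMap.comp_apply, LinearMap.comp_apply, LinearMap.proj_apply, h, map_sub, hP, hA]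
    rfl
  have hsk : IsSkew (mixedTensorField b π₁ π₂ ρ lam y) :=
    isSkew_mixedTensor b h₁.skew h₂.skew _ _
  rw [tensorEval_doubleDual_cobracket _ _ _ _ (hφ α hP hA) (hφ β hQ hC),
    schoutenVectorBivector, isSkew_iff.1 hsk (α ∘ₗ _),
    ← apply_sharp, ← apply_sharp,
    (hasFDerivAt_combinedField h₁.differentiableAt h₂.differentiableAt w).fderiv,
    sharp_mixedTensorField b α hP hA, sharp_mixedTensorField b β hQ hC]
  have hP' : ∀ η, (α ∘ₗ LinearMap.inl 𝕜 E F) (ρ η y.1) = B.ofDual η P := hP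
  have hQ' : ∀ η, (β ∘ₗ LinearMap.inl 𝕜 E F) (ρ η y.1) = B.ofDual η Q := hQ
  have hA' : ∀ x, (α ∘ₗ LinearMap.inr 𝕜 E F) (lam x y.2) = B.ofDual A x := hA
  have hC' : ∀ x, (β ∘ₗ LinearMap.inr 𝕜 E F) (lam x y.2) = B.ofDual C x := hC
  have hf := fderiv_tensorEval_mixedTensorField b h₁.differentiableAt_tensor
    h₂.differentiableAt_tensor h₁.differentiableAt h₂.differentiableAt α β hP hQ hA hC
    (ρ w.1 y.1) (-lam w.2 y.2)
  have hd : ∀ (α : Dual 𝕜 (E × F)) (f : E →L[𝕜] E) (f' : F →L[𝕜] F) v v',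
      (α ∘ₗ (f.prodMap f' : E × F →ₗ[𝕜] E × F)) (v, v')
        = (α ∘ₗ LinearMap.inl 𝕜 E F) (f v) + (α ∘ₗ LinearMap.inr 𝕜 E F) (f' v') :=
    fun α f f' v v' => by simp [← map_add]
  have l1 := h₁.apply_map_lie w.1 C (α ∘ₗ LinearMap.inl 𝕜 E F)
  have l2 := h₁.apply_map_lie w.1 A (β ∘ₗ LinearMap.inl 𝕜 E F)
  have l3 := h₂.apply_map_lie w.2 P (β ∘ₗ LinearMap.inr 𝕜 E F)
  have l4 := h₂.apply_map_lie w.2 Q (α ∘ₗ LinearMap.inr 𝕜 E F)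
  rw [hP'] at l1
  rw [hQ'] at l2
  rw [hC'] at l3
  rw [hA'] at l4
  refine (congrArg₂ (· - ·) (congrArg₂ (· - ·) hf rfl) rfl).trans ?_
  rw [hd, hd]
  refine Eq.trans ?_ (doublePairing_lie w ((P, A) : B.Double) ((Q, C) : B.Double)).symm
  simp only [map_add, map_sub, map_neg, neg_apply]
  linear_combination h₁.fderiv_apply_dual w.1 _ _ hP' hQ' - h₂.fderiv_apply_lie w.2 _ _ hA' hC'
    + l1 - l2 + l3 - l4

theorem IsPoissonActionAt.mixedTensorField (h₁ : IsPoissonActionAt B.dual 1 π₁ ρ y.1)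
    (h₂ : IsPoissonActionAt B (-1) π₂ lam y.2) :
    IsPoissonActionAt B.doubleDual 1 (mixedTensorField b π₁ π₂ ρ lam) (combinedField ρ lam) y where
  skew := isSkew_mixedTensor b h₁.skew h₂.skew _ _
  differentiableAt_tensor α β := by
    have he : (fun z => tensorEval α β (_root_.mixedTensorField b π₁ π₂ ρ lam z)) = _ :=
      funext fun z => tensorEval_mixedTensor b _ _ _ _ α β
    rw [he]
    have hfst : DifferentiableAt 𝕜 (Prod.fst : E × F → E) y := differentiableAt_fst
    have hsnd : DifferentiableAt 𝕜 (Prod.snd : E × F → F) y := differentiableAt_snd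
    have h3 := fun α (ξ : B.Dual) =>
      ((h₁.differentiableAt ξ).linearMap_comp (α ∘ₗ LinearMap.inl 𝕜 E F)).comp y hfst
    have h4 := fun α (x : g) =>
      ((h₂.differentiableAt x).linearMap_comp (α ∘ₗ LinearMap.inr 𝕜 E F)).comp y hsnd
    exact (((h₁.differentiableAt_tensor _ _).comp y hfst).add
      ((h₂.differentiableAt_tensor _ _).comp y hsnd)).sub (DifferentiableAt.fun_sum fun i _ =>
        ((h3 α _).mul (h4 β _)).sub ((h4 α _).mul (h3 β _)))
  schouten_self := schoutenBivectors_mixedTensorField b h₁ h₂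
  differentiableAt w :=
    (hasFDerivAt_combinedField h₁.differentiableAt h₂.differentiableAt w).differentiableAt
  map_lie z w := by
    have h := hasFDerivAt_combinedField h₁.differentiableAt h₂.differentiableAt
    rw [one_smul, VectorField.lieBracket, (h z).fderiv, (h w).fderiv]
    refine Prod.ext ?_ ?_
    · refine (h₁.map_lie z.1 w.1).trans ?_
      rw [one_smul]
      rfl
    -- Since `[-lam(x), -lam(y)] = [lam(x), lam(y)]`, the sign makes the anti-homomorphism `lam` a
    -- homomorphism.
    · refine (congrArg (-·) (h₂.map_lie z.2 w.2)).trans ?_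
      simp [combinedField, VectorField.lieBracket]
  schouten := schoutenVectorBivector_combinedField b h₁ h₂

end FlatCalculus

/-! ### Vector fields, tensors and Lie brackets in a chart -/

section Charts

variable {𝕜 : Type*} [RCLike 𝕜] {E : Type*} [NormedAddCommGroup E] [NormedSpace 𝕜 E]
  {H : Type*} [TopologicalSpace H] (I : ModelWithCorners 𝕜 E H)
  {M : Type*} [TopologicalSpace M] [ChartedSpace H M]

/-- The derivative at `q` of the preferred chart at `p`. -/
noncomputable def chartDeriv (p q : M) : TangentSpace I q →L[𝕜] E :=
  (mfderiv I 𝓘(𝕜, E) (extChartAt I p) q :)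

/-- A linear family of vector fields, expressed in the preferred chart at `p`. -/
noncomputable def familyInChart {g : Type*} [AddCommGroup g] [Module 𝕜 g]
    (σ : g →ₗ[𝕜] Π p : M, TangentSpace I p) (p : M) : g →ₗ[𝕜] E → E where
  toFun x := vectorInChart I (σ x) p
  map_add' x y := by
    rw [map_add]
    funext z
    exact map_add (mfderiv 𝓘(𝕜, E) I (extChartAt I p).symm z).inverse _ _
  map_smul' c x := by
    rw [map_smul]
    funext z
    exact map_smul (mfderiv 𝓘(𝕜, E) I (extChartAt I p).symm z).inverse c _

variable [I.Boundaryless] [IsManifold I 1 M]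

/-- Chart expressions are defined through the inverse of the derivative of the inverse chart. On the
chart target this is the derivative of the chart itself, which is easier to compose. -/
theorem inverse_mfderiv_extChartAt_symm {p : M} {y : E} (hy : y ∈ (extChartAt I p).target) :
    (mfderiv 𝓘(𝕜, E) I (extChartAt I p).symm y).inverse
      = chartDeriv I p ((extChartAt I p).symm y) := by
  have h1 := mfderiv_extChartAt_comp_mfderivWithin_extChartAt_symm hy
  have h2 := mfderivWithin_extChartAt_symm_comp_mfderiv_extChartAt hy
  rw [I.range_eq_univ, mfderivWithin_univ] at h1 h2
  exact ContinuousLinearMap.inverse_eq h2 h1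

theorem isInvertible_mfderiv_extChartAt_symm {p : M} {y : E}
    (hy : y ∈ (extChartAt I p).target) :
    (mfderiv 𝓘(𝕜, E) I (extChartAt I p).symm y).IsInvertible := by
  have h := isInvertible_mfderivWithin_extChartAt_symm hy
  rwa [I.range_eq_univ, mfderivWithin_univ] at h

theorem chartDeriv_inverse_apply (p : M) (v : E) :
    chartDeriv I p p ((chartDeriv I p p).inverse v) = v :=
  (isInvertible_mfderiv_extChartAt (mem_extChartAt_source p)).self_apply_inverse v

theorem inverse_chartDeriv_apply (p : M) (v : TangentSpace I p) :
    (chartDeriv I p p).inverse (chartDeriv I p p v) = v :=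
  (isInvertible_mfderiv_extChartAt (mem_extChartAt_source p)).inverse_apply_self v

theorem vectorInChart_eq (V : Π p : M, TangentSpace I p) {p : M} {y : E}
    (hy : y ∈ (extChartAt I p).target) :
    vectorInChart I V p y
      = chartDeriv I p ((extChartAt I p).symm y) (V ((extChartAt I p).symm y)) :=
  congrArg (fun f : TangentSpace I ((extChartAt I p).symm y) →L[𝕜] E => f (V _))
    (inverse_mfderiv_extChartAt_symm I hy)

theorem tensorInChart_eq (π : Π p : M, TangentSpace I p ⊗[𝕜] TangentSpace I p) {p : M} {y : E}
    (hy : y ∈ (extChartAt I p).target) :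
    tensorInChart I π p y
      = TensorProduct.map (chartDeriv I p ((extChartAt I p).symm y)).toLinearMap
        (chartDeriv I p ((extChartAt I p).symm y)).toLinearMap (π ((extChartAt I p).symm y)) :=
  congrArg (fun f : TangentSpace I ((extChartAt I p).symm y) →L[𝕜] E =>
    TensorProduct.map f.toLinearMap f.toLinearMap (π _)) (inverse_mfderiv_extChartAt_symm I hy)

theorem vectorInChart_self (V : Π p : M, TangentSpace I p) (p : M) :
    vectorInChart I V p (extChartAt I p p) = chartDeriv I p p (V p) := by
  rw [vectorInChart_eq I V (mem_extChartAt_target p), extChartAt_to_inv p]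

theorem tensorInChart_self (π : Π p : M, TangentSpace I p ⊗[𝕜] TangentSpace I p) (p : M) :
    tensorInChart I π p (extChartAt I p p)
      = TensorProduct.map (chartDeriv I p p).toLinearMap (chartDeriv I p p).toLinearMap (π p) := by
  rw [tensorInChart_eq I π (mem_extChartAt_target p), extChartAt_to_inv p]

theorem chartDeriv_mlieBracket (V W : Π p : M, TangentSpace I p) (p : M) :
    chartDeriv I p p (VectorField.mlieBracket I V W p)
      = VectorField.lieBracket 𝕜 (vectorInChart I V p) (vectorInChart I W p)
        (extChartAt I p p) := by
  rw [← VectorField.mlieBracketWithin_univ, VectorField.mlieBracketWithin_apply, I.range_eq_univ]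
  -- The manifold bracket is the flat bracket of the chart expressions, pulled back by the inverse
  -- of the chart derivative; applying the chart derivative removes the pullback.
  refine (chartDeriv_inverse_apply I p _).trans ?_
  have h : ∀ V : Π p : M, TangentSpace I p,
      VectorField.mpullbackWithin 𝓘(𝕜, E) I (extChartAt I p).symm V Set.univ
        = vectorInChart I V p := fun V =>
    VectorField.mpullbackWithin_univ
  rw [Set.preimage_univ, Set.univ_inter]
  exact (congrArg₂ (fun A B : E → E => VectorField.lieBracketWithin 𝕜 A B Set.univ
    (extChartAt I p p)) (h V) (h W)).trans (congrFun VectorField.lieBracketWithin_univ _)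

variable [IsManifold I ∞ M] [CompleteSpace E]

theorem contDiffOn_vectorInChart {V : Π p : M, TangentSpace I p}
    (hV : ContMDiff I I.tangent ∞ (fun p => (⟨p, V p⟩ : TangentBundle I M))) (p : M) :
    ContDiffOn 𝕜 ∞ (vectorInChart I V p) (extChartAt I p).target := by
  intro y hy
  have hs : ContMDiffAt 𝓘(𝕜, E) I ∞ (extChartAt I p).symm y :=
    (contMDiffOn_extChartAt_symm p).contMDiffAt ((isOpen_extChartAt_target p).mem_nhds hy)
  have h := ContMDiffAt.mpullback_vectorField_preimage (hV ((extChartAt I p).symm y)) hs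
    (isInvertible_mfderiv_extChartAt_symm I hy) le_rfl
  exact ((contMDiff_snd_tangentBundle_modelSpace E 𝓘(𝕜, E)).contMDiffAt.comp y
    h).contDiffAt.contDiffWithinAt

end Charts

/-! ### Passing between Poisson actions on a manifold and their chart expressions -/

section PoissonCharts

variable {𝕜 : Type*} [RCLike 𝕜] {E : Type*} [NormedAddCommGroup E] [NormedSpace 𝕜 E]
  {H : Type*} [TopologicalSpace H] (I : ModelWithCorners 𝕜 E H) [I.Boundaryless]
  {M : Type*} [TopologicalSpace M] [ChartedSpace H M] [IsManifold I ∞ M]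
  {g : Type*} [LieRing g] [LieAlgebra 𝕜 g]

theorem tensorEval_comp_chartDeriv_familyInChart (σ : g →ₗ[𝕜] Π p : M, TangentSpace I p)
    (p : M) (a b : Dual 𝕜 E) (t : g ⊗[𝕜] g) :
    tensorEval (a ∘ₗ (chartDeriv I p p).toLinearMap) (b ∘ₗ (chartDeriv I p p).toLinearMap)
        (actionTensor I σ t p)
      = tensorEval
        (a ∘ₗ (LinearMap.proj (extChartAt I p p) : (E → E) →ₗ[𝕜] E) ∘ₗ familyInChart I σ p)
        (b ∘ₗ (LinearMap.proj (extChartAt I p p) : (E → E) →ₗ[𝕜] E) ∘ₗ familyInChart I σ p) t := by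
  have h : ∀ a : Dual 𝕜 E,
      a ∘ₗ (LinearMap.proj (extChartAt I p p) : (E → E) →ₗ[𝕜] E) ∘ₗ familyInChart I σ p
        = (a ∘ₗ (chartDeriv I p p).toLinearMap) ∘ₗ (LinearMap.proj p ∘ₗ σ) := fun a =>
    LinearMap.ext fun x => congrArg a (vectorInChart_self I (σ x) p)
  rw [h, h]
  exact tensorEval_map _ _ _ _

/-- Together with `exists_comp_chartDeriv`, this lets identities for all covectors at `p` be
exchanged with identities for all functionals on `E`. -/
theorem covectorInChart_comp_chartDeriv (p : M) (a : Dual 𝕜 E) :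
    covectorInChart I p (a ∘ₗ (chartDeriv I p p).toLinearMap) = a :=
  LinearMap.ext fun v => congrArg a (chartDeriv_inverse_apply I p v)

theorem exists_comp_chartDeriv (p : M) (α : Dual 𝕜 (TangentSpace I p)) :
    ∃ a : Dual 𝕜 E, a ∘ₗ (chartDeriv I p p).toLinearMap = α :=
  ⟨covectorInChart I p α, LinearMap.ext fun v => congrArg α (inverse_chartDeriv_apply I p v)⟩

variable [FiniteDimensional 𝕜 E]

variable {I} in
-- Each bracket on the manifold is computed in the chart at `p`, so its identity there is already a
-- flat one. The constant `c` treats left and right actions together; the three lemmas that follow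
-- carry the flat identities back to the manifold.
theorem IsPoissonStructure.isPoissonActionAt {B : LieBialgebra 𝕜 g} {c : 𝕜}
    {π : Π p : M, TangentSpace I p ⊗[𝕜] TangentSpace I p} (hπ : IsPoissonStructure I π)
    {σ : g →ₗ[𝕜] Π p : M, TangentSpace I p}
    (hs : ∀ x, ContMDiff I I.tangent ∞ (fun p => (⟨p, σ x p⟩ : TangentBundle I M)))
    (hl : ∀ x y p, σ ⁅x, y⁆ p = c • VectorField.mlieBracket I (σ x) (σ y) p)
    (hb : ∀ x p (α β : Dual 𝕜 (TangentSpace I p)), mSchoutenVectorBivector I (σ x) π p α β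
      = tensorEval α β (actionTensor I σ (B.cobracket x) p)) (p : M) :
    IsPoissonActionAt B c (tensorInChart I π p) (familyInChart I σ p) (extChartAt I p p) where
  skew := by
    rw [tensorInChart_self]
    exact (hπ.skew p).map _
  differentiableAt_tensor a b :=
    ((hπ.smooth p a b).contDiffAt (extChartAt_target_mem_nhds p)).differentiableAt (by simp)
  schouten_self a b c := by
    have h := hπ.schouten_self p (a ∘ₗ (chartDeriv I p p).toLinearMap)
      (b ∘ₗ (chartDeriv I p p).toLinearMap) (c ∘ₗ (chartDeriv I p p).toLinearMap)
    rwa [mSchoutenBivectors, covectorInChart_comp_chartDeriv, covectorInChart_comp_chartDeriv,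
      covectorInChart_comp_chartDeriv] at h
  differentiableAt x :=
    have := FiniteDimensional.complete 𝕜 E
    ((contDiffOn_vectorInChart I (hs x) p).contDiffAt
      (extChartAt_target_mem_nhds p)).differentiableAt (by simp)
  map_lie x y := by
    refine (vectorInChart_self I _ p).trans ?_
    rw [hl, map_smul, chartDeriv_mlieBracket]
    rfl
  schouten x a b := by
    have h := hb x p (a ∘ₗ (chartDeriv I p p).toLinearMap) (b ∘ₗ (chartDeriv I p p).toLinearMap)
    rw [mSchoutenVectorBivector, covectorInChart_comp_chartDeriv, covectorInChart_comp_chartDeriv,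
      tensorEval_comp_chartDeriv_familyInChart] at h
    exact h

variable {I}

theorem IsPoissonActionAt.mSchoutenBivectors_self {B : LieBialgebra 𝕜 g} {c : 𝕜}
    {π : Π p : M, TangentSpace I p ⊗[𝕜] TangentSpace I p}
    {σ : g →ₗ[𝕜] Π p : M, TangentSpace I p} {p : M}
    (h : IsPoissonActionAt B c (tensorInChart I π p) (familyInChart I σ p) (extChartAt I p p))
    (α β γ : Dual 𝕜 (TangentSpace I p)) : mSchoutenBivectors I π π p α β γ = 0 :=
  h.schouten_self _ _ _

theorem IsPoissonActionAt.apply_lie_eq_mlieBracket {B : LieBialgebra 𝕜 g}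
    {π : Π p : M, TangentSpace I p ⊗[𝕜] TangentSpace I p}
    {σ : g →ₗ[𝕜] Π p : M, TangentSpace I p} {p : M}
    (h : IsPoissonActionAt B 1 (tensorInChart I π p) (familyInChart I σ p) (extChartAt I p p))
    (x y : g) : σ ⁅x, y⁆ p = VectorField.mlieBracket I (σ x) (σ y) p := by
  rw [← inverse_chartDeriv_apply I p (σ ⁅x, y⁆ p),
    ← inverse_chartDeriv_apply I p (VectorField.mlieBracket I (σ x) (σ y) p),
    chartDeriv_mlieBracket, ← vectorInChart_self]
  have h1 := h.map_lie x y
  rw [one_smul] at h1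
  exact congrArg _ h1

theorem IsPoissonActionAt.mSchoutenVectorBivector_eq {B : LieBialgebra 𝕜 g} {c : 𝕜}
    {π : Π p : M, TangentSpace I p ⊗[𝕜] TangentSpace I p}
    {σ : g →ₗ[𝕜] Π p : M, TangentSpace I p} {p : M}
    (h : IsPoissonActionAt B c (tensorInChart I π p) (familyInChart I σ p) (extChartAt I p p))
    (x : g) (α β : Dual 𝕜 (TangentSpace I p)) : mSchoutenVectorBivector I (σ x) π p α β
      = tensorEval α β (actionTensor I σ (B.cobracket x) p) := by
  obtain ⟨a, rfl⟩ := exists_comp_chartDeriv I p α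
  obtain ⟨b, rfl⟩ := exists_comp_chartDeriv I p β
  rw [mSchoutenVectorBivector, covectorInChart_comp_chartDeriv, covectorInChart_comp_chartDeriv,
    tensorEval_comp_chartDeriv_familyInChart]
  exact h.schouten x a b

end PoissonCharts

/-! ### Dependence on germs only -/

section Germs

variable {𝕜 : Type*} [RCLike 𝕜] {E : Type*} [NormedAddCommGroup E] [NormedSpace 𝕜 E]
  {g : Type*} [LieRing g] [LieAlgebra 𝕜 g]

open Filter Topology in
-- Only values and first derivatives at `u` enter. This is needed because the chart expression of
-- the mixed product is identified with the flat one on the chart target only.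
theorem IsPoissonActionAt.congr {B : LieBialgebra 𝕜 g} {c : 𝕜} {π π' : E → E ⊗[𝕜] E}
    {σ σ' : g →ₗ[𝕜] E → E} {u : E} (h : IsPoissonActionAt B c π σ u) (hπ : π' =ᶠ[𝓝 u] π)
    (hσ : ∀ x, σ' x =ᶠ[𝓝 u] σ x) : IsPoissonActionAt B c π' σ' u := by
  have ht : ∀ a b, (fun z => tensorEval a b (π' z)) =ᶠ[𝓝 u] fun z => tensorEval a b (π z) :=
    fun a b => hπ.mono fun z hz => congrArg (tensorEval a b) hz
  have hp : (LinearMap.proj u : (E → E) →ₗ[𝕜] E) ∘ₗ σ' = LinearMap.proj u ∘ₗ σ :=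
    LinearMap.ext fun x => (hσ x).eq_of_nhds
  refine ⟨?_, ?_, ?_, ?_, ?_, ?_⟩
  · rw [hπ.eq_of_nhds]
    exact h.skew
  · exact fun a b => (ht a b).differentiableAt_iff.2 (h.differentiableAt_tensor a b)
  · intro a b c
    rw [← h.schouten_self a b c]
    simp only [schoutenBivectors, (ht _ _).fderiv_eq, hπ.eq_of_nhds]
  · exact fun x => (hσ x).differentiableAt_iff.2 (h.differentiableAt x)
  · intro x y
    rw [(hσ _).eq_of_nhds, h.map_lie, (hσ x).lieBracket_vectorField_eq (hσ y)]
  · intro x a b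
    rw [hp, ← h.schouten]
    simp only [schoutenVectorBivector, (ht _ _).fderiv_eq, (hσ x).fderiv_eq, (hσ x).eq_of_nhds,
      hπ.eq_of_nhds]

end Germs

/-! ### Push-forward of a mixed tensor -/

section LinearAlgebra

variable {𝕜 : Type*} [Field 𝕜] {V V₁ V₂ E F : Type*} [AddCommGroup V] [Module 𝕜 V]
  [AddCommGroup V₁] [Module 𝕜 V₁] [AddCommGroup V₂] [Module 𝕜 V₂]
  [AddCommGroup E] [Module 𝕜 E] [AddCommGroup F] [Module 𝕜 F]

/-- Meant for `D` the derivative of a product chart, `j₁`, `j₂` the inclusions of the tangent spaces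
of the factors, and `D₁`, `D₂` the derivatives of the factor charts. -/
theorem map_mixed {j₁ : V₁ →ₗ[𝕜] V} {j₂ : V₂ →ₗ[𝕜] V} {D : V →ₗ[𝕜] E × F} {D₁ : V₁ →ₗ[𝕜] E}
    {D₂ : V₂ →ₗ[𝕜] F} (h₁ : ∀ v, D (j₁ v) = (D₁ v, 0)) (h₂ : ∀ v, D (j₂ v) = (0, D₂ v))
    (s : V₁ ⊗[𝕜] V₁) (t : V₂ ⊗[𝕜] V₂) {ι : Type*} [Fintype ι] (r : ι → V₁) (l : ι → V₂) :
    TensorProduct.map D D (TensorProduct.map j₁ j₁ s + TensorProduct.map j₂ j₂ t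
        - ∑ i, wedge (j₁ (r i)) (j₂ (l i)))
      = TensorProduct.map (LinearMap.inl 𝕜 E F) (LinearMap.inl 𝕜 E F) (TensorProduct.map D₁ D₁ s)
        + TensorProduct.map (LinearMap.inr 𝕜 E F) (LinearMap.inr 𝕜 E F) (TensorProduct.map D₂ D₂ t)
        - ∑ i, wedge (LinearMap.inl 𝕜 E F (D₁ (r i))) (LinearMap.inr 𝕜 E F (D₂ (l i))) := by
  have e₁ : D ∘ₗ j₁ = LinearMap.inl 𝕜 E F ∘ₗ D₁ := LinearMap.ext h₁
  have e₂ : D ∘ₗ j₂ = LinearMap.inr 𝕜 E F ∘ₗ D₂ := LinearMap.ext h₂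
  simp only [map_sub, map_add, map_sum, ← LinearMap.comp_apply, ← TensorProduct.map_comp, e₁, e₂]
  simp only [wedge, map_sub, TensorProduct.map_tmul, h₁, h₂, LinearMap.comp_apply,
    LinearMap.inl_apply, LinearMap.inr_apply]

end LinearAlgebra

/-! ### The mixed product and the combined action in a product chart -/

section ProductCharts

variable {𝕜 : Type*} [RCLike 𝕜]
  {EX : Type*} [NormedAddCommGroup EX] [NormedSpace 𝕜 EX]
  {HX : Type*} [TopologicalSpace HX] (IX : ModelWithCorners 𝕜 EX HX)
  {X : Type*} [TopologicalSpace X] [ChartedSpace HX X]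
  {EY : Type*} [NormedAddCommGroup EY] [NormedSpace 𝕜 EY]
  {HY : Type*} [TopologicalSpace HY] (IY : ModelWithCorners 𝕜 EY HY)
  {Y : Type*} [TopologicalSpace Y] [ChartedSpace HY Y]
  {g : Type*} [LieRing g] [LieAlgebra 𝕜 g] {B : LieBialgebra 𝕜 g}

theorem tangentInl_apply (q : X × Y) (v : TangentSpace IX q.1) :
    tangentInl IX IY q v = ((v, 0) : EX × EY) :=
  congrArg (fun f : EX →L[𝕜] EX × EY => f v) (mfderiv_prod_left (I := IX) (I' := IY))

theorem tangentInr_apply (q : X × Y) (v : TangentSpace IY q.2) :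
    tangentInr IX IY q v = ((0, v) : EX × EY) :=
  congrArg (fun f : EY →L[𝕜] EX × EY => f v) (mfderiv_prod_right (I := IX) (I' := IY))

variable [IsManifold IX 1 X] [IsManifold IY 1 Y]

/-- Restricted to the slice through `q`, the product chart is the chart of `X` followed by `v ↦ (v,
const)`. The chain rule for the two factorizations and uniqueness of the derivative give the claim.
-/
theorem chartDeriv_tangentInl (z : X × Y) {q : X × Y} (hq : q ∈ (extChartAt (IX.prod IY) z).source)
    (v : TangentSpace IX q.1) :
    chartDeriv (IX.prod IY) z q (tangentInl IX IY q v) = (chartDeriv IX z.1 q.1 v, 0) := by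
  have hq' : q ∈ (chartAt (ModelProd HX HY) z).source := by rwa [extChartAt_source] at hq
  have hq1 : q.1 ∈ (chartAt HX z.1).source := by
    rw [extChartAt_prod] at hq
    rw [← extChartAt_source IX]
    exact hq.1
  have h1 := (mdifferentiableAt_extChartAt (I := IX) hq1).hasMFDerivAt
  have h2 := (mdifferentiableAt_extChartAt (I := IX.prod IY) hq').hasMFDerivAt
  have hg : HasFDerivAt (fun v : EX => (v, extChartAt IY z.2 q.2)) (ContinuousLinearMap.inl 𝕜 EX EY)
    (extChartAt IX z.1 q.1) := hasFDerivAt_prodMk_left _ _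
  have hf : HasMFDerivAt IX (IX.prod IY) (fun x : X => (x, q.2)) q.1
      (mfderiv IX (IX.prod IY) (fun x : X => (x, q.2)) q.1) :=
    (mdifferentiableAt_id.prodMk mdifferentiableAt_const).hasMFDerivAt
  have h4 := hg.hasMFDerivAt.comp q.1 h1
  have h5 := HasMFDerivAt.comp q.1 (I' := IX.prod IY) (g := extChartAt (IX.prod IY) z) h2 hf
  have he : (extChartAt (IX.prod IY) z) ∘ (fun x : X => (x, q.2))
      = (fun v : EX => (v, extChartAt IY z.2 q.2)) ∘ extChartAt IX z.1 := by
    rw [extChartAt_prod]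
    rfl
  rw [he] at h5
  exact congrArg (fun f : EX →L[𝕜] EX × EY => f v) (hasMFDerivAt_unique h5 h4)

theorem chartDeriv_tangentInr (z : X × Y) {q : X × Y} (hq : q ∈ (extChartAt (IX.prod IY) z).source)
    (v : TangentSpace IY q.2) :
    chartDeriv (IX.prod IY) z q (tangentInr IX IY q v) = (0, chartDeriv IY z.2 q.2 v) := by
  have hq' : q ∈ (chartAt (ModelProd HX HY) z).source := by rwa [extChartAt_source] at hq
  have hq2 : q.2 ∈ (chartAt HY z.2).source := by
    rw [extChartAt_prod] at hq
    rw [← extChartAt_source IY]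
    exact hq.2
  have h1 := (mdifferentiableAt_extChartAt (I := IY) hq2).hasMFDerivAt
  have h2 := (mdifferentiableAt_extChartAt (I := IX.prod IY) hq').hasMFDerivAt
  have hg : HasFDerivAt (fun v : EY => (extChartAt IX z.1 q.1, v)) (ContinuousLinearMap.inr 𝕜 EX EY)
    (extChartAt IY z.2 q.2) := hasFDerivAt_prodMk_right _ _
  have hf : HasMFDerivAt IY (IX.prod IY) (fun y : Y => (q.1, y)) q.2
      (mfderiv IY (IX.prod IY) (fun y : Y => (q.1, y)) q.2) :=
    (mdifferentiableAt_const.prodMk mdifferentiableAt_id).hasMFDerivAt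
  have h4 := hg.hasMFDerivAt.comp q.2 h1
  have h5 := HasMFDerivAt.comp q.2 (I' := IX.prod IY) (g := extChartAt (IX.prod IY) z) h2 hf
  have he : (extChartAt (IX.prod IY) z) ∘ (fun y : Y => (q.1, y))
      = (fun v : EY => (extChartAt IX z.1 q.1, v)) ∘ extChartAt IY z.2 := by
    rw [extChartAt_prod]
    rfl
  rw [he] at h5
  exact congrArg (fun f : EY →L[𝕜] EX × EY => f v) (hasMFDerivAt_unique h5 h4)

theorem extChartAt_prod_symm_fst (z : X × Y) (y : EX × EY) :
    ((extChartAt (IX.prod IY) z).symm y).1 = (extChartAt IX z.1).symm y.1 := by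
  rw [extChartAt_prod]
  rfl

theorem extChartAt_prod_symm_snd (z : X × Y) (y : EX × EY) :
    ((extChartAt (IX.prod IY) z).symm y).2 = (extChartAt IY z.2).symm y.2 := by
  rw [extChartAt_prod]
  rfl

theorem mem_extChartAt_prod_target {z : X × Y} {y : EX × EY} :
    y ∈ (extChartAt (IX.prod IY) z).target
      ↔ y.1 ∈ (extChartAt IX z.1).target ∧ y.2 ∈ (extChartAt IY z.2).target := by
  rw [extChartAt_prod]
  rfl

variable [IX.Boundaryless] [IY.Boundaryless]

theorem tensorInChart_mixedProduct {ι : Type*} [Fintype ι] (b : Basis ι 𝕜 g)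
    (πX : Π p : X, TangentSpace IX p ⊗[𝕜] TangentSpace IX p)
    (πY : Π q : Y, TangentSpace IY q ⊗[𝕜] TangentSpace IY q)
    (ρ : B.Dual →ₗ[𝕜] Π p : X, TangentSpace IX p)
    (lam : g →ₗ[𝕜] Π q : Y, TangentSpace IY q) {z : X × Y} {y : EX × EY}
    (hy : y ∈ (extChartAt (IX.prod IY) z).target) :
    tensorInChart (IX.prod IY) (mixedProduct IX IY b πX πY ρ lam) z y
      = mixedTensorField b (tensorInChart IX πX z.1) (tensorInChart IY πY z.2)
        (familyInChart IX ρ z.1) (familyInChart IY lam z.2) y := by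
  have hy' := (mem_extChartAt_prod_target IX IY).1 hy
  have hq := (extChartAt (IX.prod IY) z).map_target hy
  rw [tensorInChart_eq (IX.prod IY) _ hy]
  refine (map_mixed (chartDeriv_tangentInl IX IY z hq) (chartDeriv_tangentInr IX IY z hq)
    _ _ _ _).trans ?_
  have h1 : ∀ ξ, familyInChart IX ρ z.1 ξ y.1 = _ := fun ξ => vectorInChart_eq IX (ρ ξ) hy'.1
  have h2 : ∀ x, familyInChart IY lam z.2 x y.2 = _ := fun x => vectorInChart_eq IY (lam x) hy'.2
  rw [mixedTensorField, mixedTensor, tensorInChart_eq IX πX hy'.1, tensorInChart_eq IY πY hy'.2]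
  simp only [LinearMap.comp_apply, LinearMap.proj_apply, h1, h2]
  -- The fields on the factors are evaluated at the components of the inverse product chart on one
  -- side and at the inverse factor charts on the other.
  rw [← extChartAt_prod_symm_fst IX IY z y, ← extChartAt_prod_symm_snd IX IY z y]
  rfl

theorem familyInChart_combinedAction (ρ : B.Dual →ₗ[𝕜] Π p : X, TangentSpace IX p)
    (lam : g →ₗ[𝕜] Π q : Y, TangentSpace IY q) (w : B.Dual × g) {z : X × Y} {y : EX × EY}
    (hy : y ∈ (extChartAt (IX.prod IY) z).target) :
    familyInChart (IX.prod IY) (combinedAction IX IY ρ lam) z w y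
      = combinedField (familyInChart IX ρ z.1) (familyInChart IY lam z.2) w y := by
  have hy' := (mem_extChartAt_prod_target IX IY).1 hy
  have hq := (extChartAt (IX.prod IY) z).map_target hy
  refine (vectorInChart_eq (IX.prod IY) _ hy).trans ?_
  refine ((chartDeriv (IX.prod IY) z _).map_add _ _).trans ?_
  rw [chartDeriv_tangentInl IX IY z hq, chartDeriv_tangentInr IX IY z hq, map_neg]
  have h1 : familyInChart IX ρ z.1 w.1 y.1 = _ := vectorInChart_eq IX (ρ w.1) hy'.1
  have h2 : familyInChart IY lam z.2 w.2 y.2 = _ := vectorInChart_eq IY (lam w.2) hy'.2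
  rw [← extChartAt_prod_symm_fst IX IY z y] at h1
  rw [← extChartAt_prod_symm_snd IX IY z y] at h2
  refine Prod.ext ?_ ?_
  · refine (add_zero _).trans h1.symm
  · refine (zero_add _).trans (congrArg (-·) h2.symm)

end ProductCharts

/-! ### Smoothness and skewness on the product manifold, and the theorem -/

section MainTheorem

variable {𝕜 : Type*} [RCLike 𝕜]
  {g : Type*} [LieRing g] [LieAlgebra 𝕜 g] {B : LieBialgebra 𝕜 g}
  {EX : Type*} [NormedAddCommGroup EX] [NormedSpace 𝕜 EX]
  {HX : Type*} [TopologicalSpace HX] (IX : ModelWithCorners 𝕜 EX HX)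
  {X : Type*} [TopologicalSpace X] [ChartedSpace HX X] [IsManifold IX ∞ X]
  {EY : Type*} [NormedAddCommGroup EY] [NormedSpace 𝕜 EY]
  {HY : Type*} [TopologicalSpace HY] (IY : ModelWithCorners 𝕜 EY HY)
  {Y : Type*} [TopologicalSpace Y] [ChartedSpace HY Y] [IsManifold IY ∞ Y]

theorem contMDiff_combinedAction {ρ : B.Dual →ₗ[𝕜] Π p : X, TangentSpace IX p}
    {lam : g →ₗ[𝕜] Π q : Y, TangentSpace IY q}
    (hρ : ∀ ξ, ContMDiff IX IX.tangent ∞ (fun p => (⟨p, ρ ξ p⟩ : TangentBundle IX X)))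
    (hlam : ∀ x, ContMDiff IY IY.tangent ∞ (fun q => (⟨q, lam x q⟩ : TangentBundle IY Y)))
    (w : B.Dual × g) :
    ContMDiff (IX.prod IY) (IX.prod IY).tangent ∞
      (fun z => (⟨z, combinedAction IX IY ρ lam w z⟩ : TangentBundle (IX.prod IY) (X × Y))) := by
  -- The combined field is the pair of sections `ρ(w.1)` and `lam(-w.2)`, transported through the
  -- identification of the tangent bundle of `X × Y` with the product of the tangent bundles;
  -- linearity of `lam` absorbs the sign.
  have h := (contMDiff_equivTangentBundleProd_symm (n := ∞) (I := IX) (I' := IY) (M := X)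
    (M' := Y)).comp (((hρ w.1).comp contMDiff_fst).prodMk ((hlam (-w.2)).comp contMDiff_snd))
  refine h.congr fun z => ?_
  have he : combinedAction IX IY ρ lam w z = ((ρ w.1 z.1, lam (-w.2) z.2) : EX × EY) := by
    refine (congrArg₂ (fun v v' : EX × EY => v + v') (tangentInl_apply IX IY z _)
      (tangentInr_apply IX IY z _)).trans ?_
    rw [map_neg]
    exact Prod.ext (add_zero (ρ w.1 z.1)) (zero_add (-lam w.2 z.2))
  rw [he]
  rfl

theorem isSkew_mixedProduct {ι : Type*} [Fintype ι] (b : Basis ι 𝕜 g)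
    {πX : Π p : X, TangentSpace IX p ⊗[𝕜] TangentSpace IX p}
    {πY : Π q : Y, TangentSpace IY q ⊗[𝕜] TangentSpace IY q}
    (hπX : ∀ p, IsSkew (πX p)) (hπY : ∀ q, IsSkew (πY q))
    (ρ : B.Dual →ₗ[𝕜] Π p : X, TangentSpace IX p)
    (lam : g →ₗ[𝕜] Π q : Y, TangentSpace IY q) (z : X × Y) :
    IsSkew (mixedProduct IX IY b πX πY ρ lam z) := by
  unfold mixedProduct
  exact (((hπX z.1).map (tangentInl IX IY z)).add ((hπY z.2).map (tangentInr IX IY z))).sub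
    (isSkew_sum _ fun _ => isSkew_wedge _ _)

variable [IX.Boundaryless] [IY.Boundaryless] [FiniteDimensional 𝕜 EX] [FiniteDimensional 𝕜 EY]

/-- In a product chart the components are those of the two bivector fields plus a finite sum of
products of components of the vector fields, each pulled back from a factor. -/
theorem contDiffOn_tensorEval_mixedProduct {ι : Type*} [Fintype ι] (b : Basis ι 𝕜 g)
    {πX : Π p : X, TangentSpace IX p ⊗[𝕜] TangentSpace IX p}
    {πY : Π q : Y, TangentSpace IY q ⊗[𝕜] TangentSpace IY q}
    {ρ : B.Dual →ₗ[𝕜] Π p : X, TangentSpace IX p} {lam : g →ₗ[𝕜] Π q : Y, TangentSpace IY q}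
    (hπX : IsBivectorField IX πX) (hπY : IsBivectorField IY πY)
    (hρ : ∀ ξ, ContMDiff IX IX.tangent ∞ (fun p => (⟨p, ρ ξ p⟩ : TangentBundle IX X)))
    (hlam : ∀ x, ContMDiff IY IY.tangent ∞ (fun q => (⟨q, lam x q⟩ : TangentBundle IY Y)))
    (z : X × Y) (α β : Dual 𝕜 (EX × EY)) :
    ContDiffOn 𝕜 ∞ (fun y => tensorEval α β
        (tensorInChart (IX.prod IY) (mixedProduct IX IY b πX πY ρ lam) z y))
      (extChartAt (IX.prod IY) z).target := by
  have := FiniteDimensional.complete 𝕜 EX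
  have := FiniteDimensional.complete 𝕜 EY
  have m1 : Set.MapsTo Prod.fst (extChartAt (IX.prod IY) z).target (extChartAt IX z.1).target :=
    fun y hy => ((mem_extChartAt_prod_target IX IY).1 hy).1
  have m2 : Set.MapsTo Prod.snd (extChartAt (IX.prod IY) z).target (extChartAt IY z.2).target :=
    fun y hy => ((mem_extChartAt_prod_target IX IY).1 hy).2
  have h1 := fun ξ (a : Dual 𝕜 EX) => ((LinearMap.toContinuousLinearMap a).contDiff.comp_contDiffOn
    (contDiffOn_vectorInChart IX (hρ ξ) z.1)).comp contDiff_fst.contDiffOn m1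
  have h2 := fun x (a : Dual 𝕜 EY) => ((LinearMap.toContinuousLinearMap a).contDiff.comp_contDiffOn
    (contDiffOn_vectorInChart IY (hlam x) z.2)).comp contDiff_snd.contDiffOn m2
  have h := (((hπX.smooth z.1 (α ∘ₗ LinearMap.inl 𝕜 EX EY) (β ∘ₗ LinearMap.inl 𝕜 EX EY)).comp
    contDiff_fst.contDiffOn m1).add ((hπY.smooth z.2 (α ∘ₗ LinearMap.inr 𝕜 EX EY)
    (β ∘ₗ LinearMap.inr 𝕜 EX EY)).comp contDiff_snd.contDiffOn m2)).sub
    (ContDiffOn.sum (s := Finset.univ) fun i _ =>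
      ((h1 (B.toDual (b.coord i)) (α ∘ₗ LinearMap.inl 𝕜 EX EY)).mul
        (h2 (b i) (β ∘ₗ LinearMap.inr 𝕜 EX EY))).sub
      ((h2 (b i) (α ∘ₗ LinearMap.inr 𝕜 EX EY)).mul
        (h1 (B.toDual (b.coord i)) (β ∘ₗ LinearMap.inl 𝕜 EX EY))))
  refine h.congr fun y hy => ?_
  rw [tensorInChart_mixedProduct IX IY b πX πY ρ lam hy]
  exact tensorEval_mixedTensor b _ _ _ _ α β

end MainTheorem

theorem mainTheorem7
    {𝕜 : Type*} [RCLike 𝕜]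
    {g : Type*} [LieRing g] [LieAlgebra 𝕜 g] [FiniteDimensional 𝕜 g]
    (B : LieBialgebra 𝕜 g)
    {EX : Type*} [NormedAddCommGroup EX] [NormedSpace 𝕜 EX] [FiniteDimensional 𝕜 EX]
    {HX : Type*} [TopologicalSpace HX] (IX : ModelWithCorners 𝕜 EX HX) [IX.Boundaryless]
    {X : Type*} [TopologicalSpace X] [ChartedSpace HX X] [IsManifold IX ∞ X]
    {EY : Type*} [NormedAddCommGroup EY] [NormedSpace 𝕜 EY] [FiniteDimensional 𝕜 EY]
    {HY : Type*} [TopologicalSpace HY] (IY : ModelWithCorners 𝕜 EY HY) [IY.Boundaryless]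
    {Y : Type*} [TopologicalSpace Y] [ChartedSpace HY Y] [IsManifold IY ∞ Y]
    (πX : Π p : X, TangentSpace IX p ⊗[𝕜] TangentSpace IX p)
    (ρ : B.Dual →ₗ[𝕜] Π p : X, TangentSpace IX p)
    (hπX : IsPoissonStructure IX πX) (hρ : IsRightPoissonAction IX B.dual πX ρ)
    (πY : Π q : Y, TangentSpace IY q ⊗[𝕜] TangentSpace IY q)
    (lam : g →ₗ[𝕜] Π q : Y, TangentSpace IY q)
    (hπY : IsPoissonStructure IY πY) (hlam : IsLeftPoissonAction IY B πY lam)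
    {ι : Type*} [Fintype ι] (b : Module.Basis ι 𝕜 g) :
    IsPoissonStructure (IX.prod IY) (mixedProduct IX IY b πX πY ρ lam) ∧
      IsRightPoissonAction (IX.prod IY) B.doubleDual (mixedProduct IX IY b πX πY ρ lam)
        (combinedAction IX IY ρ lam) := by
  have h₁ := hπX.isPoissonActionAt hρ.smooth (c := 1) (fun x y p => by rw [one_smul, hρ.map_lie])
    hρ.schouten
  have h₂ := hπY.isPoissonActionAt hlam.smooth (c := -1)
    (fun x y p => by rw [neg_one_smul, hlam.map_lie]) hlam.schouten
  have h : ∀ z, IsPoissonActionAt B.doubleDual 1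
      (tensorInChart (IX.prod IY) (mixedProduct IX IY b πX πY ρ lam) z)
      (familyInChart (IX.prod IY) (combinedAction IX IY ρ lam) z)
      (extChartAt (IX.prod IY) z z) := fun z =>
    -- The components of the product chart at `z` are by definition the factor charts at `z.1` and
    -- `z.2`, so the two flat hypotheses apply at the components of the same point.
    ((h₁ z.1).mixedTensorField b (y := extChartAt (IX.prod IY) z z) (h₂ z.2)).congr
      (Filter.eventually_of_mem (extChartAt_target_mem_nhds z) fun y hy =>
        tensorInChart_mixedProduct IX IY b πX πY ρ lam hy)
      fun w => Filter.eventually_of_mem (extChartAt_target_mem_nhds z) fun y hy =>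
        familyInChart_combinedAction IX IY ρ lam w hy
  exact ⟨⟨⟨isSkew_mixedProduct IX IY b hπX.skew hπY.skew ρ lam,
        contDiffOn_tensorEval_mixedProduct IX IY b hπX.toIsBivectorField hπY.toIsBivectorField
          hρ.smooth hlam.smooth⟩,
      fun z α β γ => (h z).mSchoutenBivectors_self α β γ⟩,
    contMDiff_combinedAction IX IY hρ.smooth hlam.smooth,
    fun w w' z => (h z).apply_lie_eq_mlieBracket w w',
    fun w z α β => (h z).mSchoutenVectorBivector_eq w α β⟩
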